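/- Let $n\ge 1$, let $\Omega\subset\mathbb{R}^n$ be a bounded domain (nonempty connected open set), and let $0<\lambda_1\le\lambda_2\le\lambda_3\le\cdots$ be the eigenvalues of the Dirichlet Laplacian on $\Omega$, i.e. of the problem $-\Delta u=\lambda u$ in $\Omega$, $u=0$ on $\partial\Omega$, understood weakly ($u\in H^1_0(\Omega)$ and $\int_\Omega\nabla u\cdot\nabla v=\lambda\int_\Omega uv$ for all $v\in H^1_0(\Omega)$), each repeated according to its multiplicity. Then for every $m=1,2,\ldots$ the Hile--Protter inequality $$\sum_{i=1}^m\frac{\lambda_i}{\lambda_{m+1}-\lambda_i}\ \ge\ \frac{mn}{4}$$ holds, where the left-hand side is read as $+\infty$ if $\lambda_{m+1}=\lambda_i$ for some $i\le m$ (equivalently, if $\lambda_{m+1}=\lambda_m$); in particular it holds as an inequality between real numbers whenever $\lambda_m<\lambda_{m+1}$. Consequently the Payne--P\'olya--Weinberger inequality $$\lambda_{m+1}-\lambda_m\ \le\ \frac{4}{mn}\sum_{i=1}^m\lambda_i$$ holds for every $m=1,2,\ldots$. -/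

import Mathlib

open MeasureTheory
open scoped ENNReal Gradient

/-- Test functions on `Ω`: smooth real functions with compact support contained in `Ω`. -/
def IsTestFunction {n : ℕ} (Ω : Set (EuclideanSpace ℝ (Fin n)))
    (φ : EuclideanSpace ℝ (Fin n) → ℝ) : Prop :=
  ContDiff ℝ ((⊤ : ℕ∞) : WithTop ℕ∞) φ ∧ HasCompactSupport φ ∧ tsupport φ ⊆ Ω

/-- The Hilbert space `L²(Ω)` of real functions. -/
abbrev L2Fun {n : ℕ} (Ω : Set (EuclideanSpace ℝ (Fin n))) : Type :=
  Lp ℝ 2 (volume.restrict Ω)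

/-- The Hilbert space `L²(Ω; ℝⁿ)` of vector fields. -/
abbrev L2Field {n : ℕ} (Ω : Set (EuclideanSpace ℝ (Fin n))) : Type :=
  Lp (EuclideanSpace ℝ (Fin n)) 2 (volume.restrict Ω)

/-- The pairs `(φ, ∇φ)` in `L²(Ω) × L²(Ω; ℝⁿ)`, for `φ` a test function on `Ω`. -/
def testPairs {n : ℕ} (Ω : Set (EuclideanSpace ℝ (Fin n))) : Set (L2Fun Ω × L2Field Ω) :=
  {p | ∃ φ : EuclideanSpace ℝ (Fin n) → ℝ, IsTestFunction Ω φ ∧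
    p.1 =ᵐ[volume.restrict Ω] φ ∧ p.2 =ᵐ[volume.restrict Ω] ∇ φ}

/-- The Sobolev space `H¹₀(Ω)`, the closure of the test functions in the `H¹` norm. An element
`u` is given together with its weak gradient, as the pair `(u, ∇u)` (the second component is
determined by the first). -/
def H10 {n : ℕ} (Ω : Set (EuclideanSpace ℝ (Fin n))) : Set (L2Fun Ω × L2Field Ω) :=
  closure (testPairs Ω)

/-- `u` solves the fixed membrane problem `-Δu = μ u` in `Ω`, `u = 0` on `∂Ω`:
`u ∈ H¹₀(Ω)` and `∫_Ω ∇u · ∇v = μ ∫_Ω u v` for every `v ∈ H¹₀(Ω)`.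
(The zero function is allowed here.) -/
def SolvesDirichletEigenproblem {n : ℕ} (Ω : Set (EuclideanSpace ℝ (Fin n))) (μ : ℝ)
    (u : L2Fun Ω) : Prop :=
  ∃ g : L2Field Ω, (u, g) ∈ H10 Ω ∧
    ∀ p ∈ H10 Ω, inner ℝ g p.2 = μ * inner ℝ u p.1

/-- The `k`-th eigenvalue (`k = 1, 2, …`) of the Dirichlet Laplacian on `Ω`, in nondecreasing
order and repeated according to multiplicity: the least `t` such that there are `k` linearly
independent eigenfunctions with eigenvalues at most `t`. -/
noncomputable def dirichletEigenvalue {n : ℕ} (Ω : Set (EuclideanSpace ℝ (Fin n)))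
    (k : ℕ) : ℝ :=
  sInf {t : ℝ | ∃ u : Fin k → L2Fun Ω, LinearIndependent ℝ u ∧
    ∀ i, ∃ μ ≤ t, SolvesDirichletEigenproblem Ω μ (u i)}

/-! Let u_1, u_2, … be orthonormal Dirichlet eigenfunctions, x a coordinate and ∂ the matching
partial derivative. Subtracting from x u_i its projection onto u_1, …, u_m leaves a function φ_i
that is admissible in the Rayleigh quotient for λ_{m+1}. Since -Δ(x u_i) = λ_i x u_i - 2 ∂u_i, one
gets ‖∇φ_i‖² = λ_i ‖φ_i‖² + w_i with w_i = -2⟨∂u_i, φ_i⟩, hence (λ_{m+1} - λ_i)‖φ_i‖² ≤ w_i.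
Cauchy–Schwarz, w_i² ≤ 4‖∂u_i‖²‖φ_i‖², eliminates φ_i and leaves w_i ≤ 4‖∂u_i‖²/(λ_{m+1} - λ_i).
Integration by parts shows w_i = 1 + 2 ∑_j a_ij b_ij with a symmetric and b antisymmetric, so ∑ w_i
= m (`IsCoordinate.natCast_le_sum`). Summing over the n coordinates turns ‖∂u_i‖² into ‖∇u_i‖² = λ_i
(`hileProtter`).

The remainder is spectral theory. Eigenpairs come from successive minimisation of the Rayleigh
quotient (`IsEigensystem.succ`); minima are attained because bounded sets of H¹₀ are totally bounded
in L², which follows from a Friedrichs inequality obtained by mollification (`exists_friedrichs`).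
The minimisation never stops: otherwise multiplication by a coordinate would be a symmetric operator
on a nonzero finite-dimensional space without an eigenvector (`exists_isEigensystem`). Finally
`IsEigensystem.sInf_eq` matches the minima with the counting definition of the eigenvalues. -/

section Abstract

/-! ### Variational spectral theory for pairs (u, ∇u) in an abstract product space L × G. -/

variable {L G : Type*} [NormedAddCommGroup L] [InnerProductSpace ℝ L]
  [NormedAddCommGroup G]

/-- A Friedrichs inequality on `V` makes sets of first components of bounded elements of `V`
totally bounded. -/
theorem totallyBounded_fst_of_friedrichs {V : Set (L × G)}
    (hF : ∀ ε > (0 : ℝ), ∃ (N : ℕ) (f : Fin N → L), ∀ p ∈ V, ∀ q ∈ V,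
      ‖p.1 - q.1‖ ≤ ε * ‖p.2 - q.2‖ + ∑ j, |inner ℝ (f j) (p.1 - q.1)|) (R : ℝ) :
    TotallyBounded {u : L | ∃ p ∈ V, p.1 = u ∧ ‖p.1‖ ≤ R ∧ ‖p.2‖ ≤ R} := by
  refine Metric.totallyBounded_of_finite_discretization fun ε hε => ?_
  have hR : 0 < 2 * |R| + 1 := by positivity
  obtain ⟨N, f, hf⟩ := hF (ε / 2 / (2 * |R| + 1)) (by positivity)
  -- Each u is encoded by the integer parts of its N functionals in units of δ. Two elements with
  -- the same code differ by at most ε/2 from the gradient term plus Nδ ≤ ε/4 from the functionals.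
  set δ : ℝ := ε / 4 / (N + 1) with hδ
  have hδ0 : 0 < δ := by positivity
  obtain ⟨M, hM⟩ : ∃ M : ℤ, ∀ u : L, ‖u‖ ≤ R → ∀ j, ⌊inner ℝ (f j) u / δ⌋ ∈ Set.Icc (-M) M := by
    obtain ⟨B, hB⟩ := exists_nat_gt ((∑ j, ‖f j‖) * |R| / δ)
    refine ⟨B + 1, fun u hu j => ?_⟩
    have h1 : |inner ℝ (f j) u| ≤ (∑ j, ‖f j‖) * |R| :=
      (abs_real_inner_le_norm _ _).trans (mul_le_mul
        (Finset.single_le_sum (f := fun j => ‖f j‖) (fun _ _ => norm_nonneg _) (Finset.mem_univ j))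
        (hu.trans (le_abs_self R)) (norm_nonneg _) (Finset.sum_nonneg fun _ _ => norm_nonneg _))
    have h2 : |inner ℝ (f j) u / δ| ≤ B := by
      rw [abs_div, abs_of_pos hδ0]
      exact (div_le_div_of_nonneg_right h1 hδ0.le).trans hB.le
    have h3 := abs_le.1 h2
    have h4 := Int.floor_le (inner ℝ (f j) u / δ)
    have h5 := Int.lt_floor_add_one (inner ℝ (f j) u / δ)
    constructor
    · have : (-(B : ℝ)) < ((⌊inner ℝ (f j) u / δ⌋ + 1 : ℤ) : ℝ) := by
        push_cast; linarith [h3.1]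
      have : -(B : ℤ) < ⌊inner ℝ (f j) u / δ⌋ + 1 := by exact_mod_cast this
      omega
    · have : ((⌊inner ℝ (f j) u / δ⌋ : ℤ) : ℝ) ≤ B := h4.trans h3.2
      have : ⌊inner ℝ (f j) u / δ⌋ ≤ (B : ℤ) := by exact_mod_cast this
      omega
  refine ⟨ULift (Fin N → Set.Icc (-M) M), inferInstance, fun u => ⟨fun j =>
    ⟨⌊inner ℝ (f j) u.1 / δ⌋, hM u.1 (by obtain ⟨p, _, hp, h, _⟩ := u.2; rwa [← hp]) j⟩⟩, ?_⟩
  rintro ⟨_, p, hp, rfl, hp1, hp2⟩ ⟨_, q, hq, rfl, hq1, hq2⟩ h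
  rw [dist_eq_norm]
  have hsum : ∑ j, |inner ℝ (f j) (p.1 - q.1)| ≤ ∑ _j : Fin N, δ := by
    refine Finset.sum_le_sum fun j _ => ?_
    have h1 : ⌊inner ℝ (f j) p.1 / δ⌋ = ⌊inner ℝ (f j) q.1 / δ⌋ :=
      congrArg Subtype.val (congrFun (congrArg ULift.down h) j)
    have h2 := Int.abs_sub_lt_one_of_floor_eq_floor h1
    rw [← sub_div, abs_div, abs_of_pos hδ0, div_lt_one hδ0, ← inner_sub_right] at h2
    exact h2.le
  have hn : ‖p.2 - q.2‖ ≤ 2 * |R| + 1 := by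
    have := norm_sub_le p.2 q.2
    linarith [le_abs_self R]
  have h1 := hf p hp q hq
  have h2 : ε / 2 / (2 * |R| + 1) * ‖p.2 - q.2‖ ≤ ε / 2 := by
    rw [div_mul_eq_mul_div, div_le_iff₀ hR]
    exact mul_le_mul_of_nonneg_left hn (by positivity)
  have h3 : ∑ _j : Fin N, δ ≤ ε / 4 := by
    rw [Finset.sum_const, Finset.card_univ, Fintype.card_fin, nsmul_eq_mul, hδ,
      mul_div_assoc', div_le_iff₀ (by positivity)]
    nlinarith
  linarith

variable [InnerProductSpace ℝ G]

/-- The minimum of `‖p.2‖² / ‖p.1‖²` over a closed subspace is attained. -/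
theorem exists_rayleigh_minimizer [CompleteSpace L] [CompleteSpace G] {W : Submodule ℝ (L × G)}
    (hW : IsClosed (W : Set (L × G)))
    (hc : ∀ R, TotallyBounded {u : L | ∃ p ∈ W, p.1 = u ∧ ‖p.1‖ ≤ R ∧ ‖p.2‖ ≤ R})
    (hne : ∃ p ∈ W, p.1 ≠ 0) :
    ∃ p ∈ W, ‖p.1‖ = 1 ∧ ∀ q ∈ W, ‖p.2‖ ^ 2 * ‖q.1‖ ^ 2 ≤ ‖q.2‖ ^ 2 := by
  set S : Set ℝ := {t | ∃ p ∈ W, ‖p.1‖ = 1 ∧ ‖p.2‖ ^ 2 = t} with hS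
  have hbdd : BddBelow S := ⟨0, by rintro _ ⟨p, _, _, rfl⟩; positivity⟩
  have hnorm : ∀ p ∈ W, p.1 ≠ 0 → ‖p.2‖ ^ 2 / ‖p.1‖ ^ 2 ∈ S := by
    intro p hp h0
    refine ⟨(‖p.1‖⁻¹ : ℝ) • p, W.smul_mem _ hp, ?_, ?_⟩
    · rw [Prod.smul_fst, norm_smul, norm_inv, norm_norm, inv_mul_cancel₀ (norm_ne_zero_iff.2 h0)]
    · rw [Prod.smul_snd, norm_smul, norm_inv, norm_norm]
      field_simp
  have hSne : S.Nonempty := by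
    obtain ⟨p, hp, h0⟩ := hne
    exact ⟨_, hnorm p hp h0⟩
  set μ := sInf S with hμ
  have hmin : ∀ q ∈ W, μ * ‖q.1‖ ^ 2 ≤ ‖q.2‖ ^ 2 := by
    intro q hq
    by_cases h0 : q.1 = 0
    · rw [h0, norm_zero]; nlinarith [sq_nonneg ‖q.2‖]
    · have := csInf_le hbdd (hnorm q hq h0)
      rwa [le_div_iff₀ (by positivity)] at this
  have hμ0 : 0 ≤ μ := le_csInf hSne (by rintro _ ⟨p, _, _, rfl⟩; positivity)
  obtain ⟨t, -, ht, htS⟩ := exists_seq_tendsto_sInf hSne hbdd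
  choose p hpW hp1 hp2 using htS
  have hbt : ∃ B, ∀ k, t k ≤ B := by
    obtain ⟨B, hB⟩ := ht.bddAbove_range
    exact ⟨B, fun k => hB ⟨k, rfl⟩⟩
  obtain ⟨B, hB⟩ := hbt
  -- B + 1 bounds both components: the first has norm 1 and the second satisfies s² ≤ B, so 2s ≤ s²
  -- + 1 ≤ B + 1.
  have hK := ((hc (B + 1)).closure).isCompact_of_isClosed isClosed_closure
  have hmem : ∀ k, (p k).1 ∈ closure {u : L | ∃ q ∈ W, q.1 = u ∧ ‖q.1‖ ≤ B + 1 ∧ ‖q.2‖ ≤ B + 1} := by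
    intro k
    have hk : ‖(p k).2‖ ^ 2 ≤ B := (hp2 k).trans_le (hB k)
    refine subset_closure ⟨p k, hpW k, rfl, ?_, ?_⟩
    · rw [hp1]; nlinarith [sq_nonneg ‖(p k).2‖]
    · nlinarith [sq_nonneg (‖(p k).2‖ - 1)]
  obtain ⟨u, -, σ, hσ, hu⟩ := hK.tendsto_subseq hmem
  have ht' : Filter.Tendsto (fun k => t (σ k)) Filter.atTop (nhds μ) :=
    ht.comp hσ.tendsto_atTop
  -- Total boundedness only makes the first components converge. For the second, the parallelogram
  -- law and minimality applied to x + y give ‖x.2 - y.2‖² ≤ 2(t - μ) + 2(t' - μ) + μ‖x.1 - y.1‖² <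
  -- 4η + μη².
  have hcauchy : CauchySeq fun k => (p (σ k)).2 := by
    rw [Metric.cauchySeq_iff']
    intro ε hε
    have hcu := hu.cauchySeq
    rw [Metric.cauchySeq_iff] at hcu
    obtain ⟨η, hη0, hη⟩ : ∃ η > (0 : ℝ), 4 * η + μ * η ^ 2 < ε ^ 2 := by
      have hcont : Filter.Tendsto (fun η : ℝ => 4 * η + μ * η ^ 2) (nhdsWithin 0 (Set.Ioi 0))
          (nhds (4 * 0 + μ * 0 ^ 2)) :=
        (Continuous.tendsto (by fun_prop) _).mono_left nhdsWithin_le_nhds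
      have h1 := hcont.eventually_lt_const (u := ε ^ 2) (by
        have : 0 < ε ^ 2 := by positivity
        simpa using this)
      obtain ⟨η, h1, h2⟩ := (h1.and self_mem_nhdsWithin).exists
      exact ⟨η, h2, h1⟩
    obtain ⟨N₁, hN₁⟩ := hcu η hη0
    obtain ⟨N₂, hN₂⟩ := Filter.eventually_atTop.1
      (ht'.eventually (gt_mem_nhds (show μ < μ + η by linarith)))
    refine ⟨max N₁ N₂, fun k hk => ?_⟩
    have a1 := hN₂ k (le_trans (le_max_right _ _) hk)
    have a2 := hN₂ (max N₁ N₂) (le_max_right _ _)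
    have a3 := hN₁ k (le_trans (le_max_left _ _) hk) (max N₁ N₂) (le_max_left _ _)
    rw [dist_eq_norm] at a3 ⊢
    set x := p (σ k)
    set y := p (σ (max N₁ N₂))
    have b1 := hmin (x + y) (W.add_mem (hpW _) (hpW _))
    have b2 := parallelogram_law_with_norm ℝ x.1 y.1
    have b3 := parallelogram_law_with_norm ℝ x.2 y.2
    rw [Prod.fst_add, Prod.snd_add] at b1
    have c1 : ‖x.1‖ = 1 := hp1 _
    have c2 : ‖y.1‖ = 1 := hp1 _
    have c3 : ‖x.2‖ ^ 2 = t (σ k) := hp2 _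
    have c4 : ‖y.2‖ ^ 2 = t (σ (max N₁ N₂)) := hp2 _
    have d : ‖x.1 - y.1‖ ^ 2 ≤ η ^ 2 := pow_le_pow_left₀ (norm_nonneg _) (le_of_lt a3) 2
    have e : ‖x.2 - y.2‖ ^ 2 < ε ^ 2 := by
      have d' := mul_le_mul_of_nonneg_left d hμ0
      rw [c1, c2] at b2
      have b2' : μ * ‖x.1 + y.1‖ ^ 2 = 4 * μ - μ * ‖x.1 - y.1‖ ^ 2 := by
        linear_combination μ * b2
      nlinarith
    exact lt_of_pow_lt_pow_left₀ 2 hε.le e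
  obtain ⟨g, hg⟩ := cauchySeq_tendsto_of_complete hcauchy
  have hlim : Filter.Tendsto (fun k => p (σ k)) Filter.atTop (nhds (u, g)) :=
    (show Filter.Tendsto (fun k => (p (σ k)).1) Filter.atTop (nhds u) from hu).prodMk_nhds hg
  have hgn : ‖g‖ ^ 2 = μ := by
    refine tendsto_nhds_unique (hg.norm.pow 2) ?_
    simpa only [hp2] using ht'
  refine ⟨(u, g), hW.mem_of_tendsto hlim (Filter.Eventually.of_forall fun k => hpW _), ?_, ?_⟩
  · refine tendsto_nhds_unique hu.norm ?_
    simp only [Function.comp_def, hp1]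
    exact tendsto_const_nhds
  · simpa only [hgn] using hmin

/-- The Euler–Lagrange equation of a minimizer of `‖p.2‖² / ‖p.1‖²`. -/
theorem inner_snd_eq_of_minimizer {W : Submodule ℝ (L × G)} {p : L × G} (hp : p ∈ W)
    (hp1 : ‖p.1‖ = 1) (hmin : ∀ q ∈ W, ‖p.2‖ ^ 2 * ‖q.1‖ ^ 2 ≤ ‖q.2‖ ^ 2) {q : L × G}
    (hq : q ∈ W) : inner ℝ p.2 q.2 = ‖p.2‖ ^ 2 * inner ℝ p.1 q.1 := by
  -- Minimality at p + t q is a nonnegative quadratic in t with zero constant term, so its linear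
  -- coefficient vanishes.
  have key : ∀ t : ℝ, 0 ≤ (‖q.2‖ ^ 2 - ‖p.2‖ ^ 2 * ‖q.1‖ ^ 2) * (t * t) +
      (2 * (inner ℝ p.2 q.2 - ‖p.2‖ ^ 2 * inner ℝ p.1 q.1)) * t + 0 := by
    intro t
    have h := hmin (p + t • q) (W.add_mem hp (W.smul_mem t hq))
    simp only [Prod.fst_add, Prod.snd_add, Prod.smul_fst, Prod.smul_snd] at h
    rw [norm_add_sq_real, norm_add_sq_real, norm_smul, norm_smul, inner_smul_right,
      inner_smul_right, mul_pow, mul_pow, Real.norm_eq_abs, sq_abs, hp1] at h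
    nlinarith
  have h := discrim_le_zero key
  rw [discrim] at h
  have : (inner ℝ p.2 q.2 - ‖p.2‖ ^ 2 * inner ℝ p.1 q.1) ^ 2 ≤ 0 := by nlinarith
  have := pow_eq_zero_iff (two_ne_zero) |>.1 (le_antisymm this (sq_nonneg _))
  linarith

/-- The first `k` steps of the variational construction of eigenpairs of the quadratic form
`‖p.2‖²` with respect to `‖p.1‖²` on `V`. -/
structure IsEigensystem (V : Submodule ℝ (L × G)) (k : ℕ) (p : ℕ → L × G) (l : ℕ → ℝ) :
    Prop where
  mem : ∀ i < k, p i ∈ V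
  eig : ∀ i < k, ∀ q ∈ V, inner ℝ (p i).2 q.2 = l i * inner ℝ (p i).1 q.1
  norm : ∀ i < k, ‖(p i).1‖ = 1
  orth : ∀ i < k, ∀ j < k, i ≠ j → inner ℝ (p i).1 (p j).1 = 0
  min : ∀ i < k, ∀ q ∈ V, (∀ j < i, inner ℝ (p j).1 q.1 = 0) → l i * ‖q.1‖ ^ 2 ≤ ‖q.2‖ ^ 2

namespace IsEigensystem

variable {V : Submodule ℝ (L × G)} {k : ℕ} {p : ℕ → L × G} {l : ℕ → ℝ}

theorem of_le (h : IsEigensystem V k p l) {k' : ℕ} (hk : k' ≤ k) : IsEigensystem V k' p l :=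
  ⟨fun i hi => h.mem i (hi.trans_le hk), fun i hi => h.eig i (hi.trans_le hk),
    fun i hi => h.norm i (hi.trans_le hk),
    fun i hi j hj => h.orth i (hi.trans_le hk) j (hj.trans_le hk),
    fun i hi => h.min i (hi.trans_le hk)⟩

theorem norm_snd_sq (h : IsEigensystem V k p l) {i : ℕ} (hi : i < k) : ‖(p i).2‖ ^ 2 = l i := by
  rw [← real_inner_self_eq_norm_sq, h.eig i hi _ (h.mem i hi), real_inner_self_eq_norm_sq,
    h.norm i hi]
  ring

/-- `p j` is a competitor in the minimisation that defines `l i`. -/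
theorem monotone (h : IsEigensystem V k p l) {i j : ℕ} (hij : i ≤ j) (hj : j < k) :
    l i ≤ l j := by
  have := h.min i (hij.trans_lt hj) (p j) (h.mem j hj)
    fun a ha => h.orth a (by omega) j hj (by omega)
  rwa [h.norm j hj, h.norm_snd_sq hj, one_pow, mul_one] at this

theorem inner_fst (h : IsEigensystem V k p l) {i j : ℕ} (hi : i < k) (hj : j < k) :
    inner ℝ (p i).1 (p j).1 = if i = j then (1 : ℝ) else 0 := by
  split_ifs with hij
  · subst hij; rw [real_inner_self_eq_norm_sq, h.norm i hi]; norm_num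
  · exact h.orth i hi j hj hij

/-- The projection onto the orthogonal complement of the first components of `p 0, …, p (k-1)`. -/
theorem inner_sub_sum (h : IsEigensystem V k p l) (q : L × G) {j : ℕ} (hj : j < k) :
    inner ℝ (p j).1 (q - ∑ i ∈ Finset.range k, inner ℝ (p i).1 q.1 • p i).1 = 0 := by
  rw [Prod.fst_sub, Prod.fst_sum, inner_sub_right, inner_sum, Finset.sum_eq_single j]
  · rw [Prod.smul_fst, inner_smul_right, h.inner_fst hj hj]; simp
  · intro i hi hij
    rw [Prod.smul_fst, inner_smul_right, h.inner_fst hj (Finset.mem_range.1 hi), if_neg hij.symm,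
      mul_zero]
  · intro hj'; exact absurd (Finset.mem_range.2 hj) hj'

theorem sub_sum_mem (h : IsEigensystem V k p l) {q : L × G} (hq : q ∈ V) (c : ℕ → ℝ) :
    q - ∑ i ∈ Finset.range k, c i • p i ∈ V :=
  V.sub_mem hq (V.sum_mem fun i hi => V.smul_mem _ (h.mem i (Finset.mem_range.1 hi)))

theorem zero : IsEigensystem V 0 p l :=
  ⟨by simp, by simp, by simp, by simp, by simp⟩

/-- The new pair minimises the Rayleigh quotient on the part of V orthogonal to the earlier
eigenvectors. Its Euler–Lagrange equation holds at first only against that part; it extends to all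
of V because the earlier eigenvectors are orthogonal to the minimiser in both components. -/
theorem succ [CompleteSpace L] [CompleteSpace G] (h : IsEigensystem V k p l)
    (hV : IsClosed (V : Set (L × G)))
    (hc : ∀ R, TotallyBounded {u : L | ∃ p ∈ V, p.1 = u ∧ ‖p.1‖ ≤ R ∧ ‖p.2‖ ≤ R})
    (hne : ∃ q ∈ V, (∀ j < k, inner ℝ (p j).1 q.1 = 0) ∧ q.1 ≠ 0) :
    ∃ p' l', IsEigensystem V (k + 1) p' l' := by
  let W : Submodule ℝ (L × G) := V ⊓ ⨅ j : Fin k,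
    LinearMap.ker ((innerₛₗ ℝ (p j).1).comp (LinearMap.fst ℝ L G))
  have hWmem : ∀ q, q ∈ W ↔ q ∈ V ∧ ∀ j < k, inner ℝ (p j).1 q.1 = 0 := by
    intro q
    simp only [W, Submodule.mem_inf, Submodule.mem_iInf, LinearMap.mem_ker, Fin.forall_iff]
    rfl
  have hWc : IsClosed (W : Set (L × G)) := by
    have : (W : Set (L × G)) = (V : Set (L × G)) ∩ ⋂ j : Fin k, {q : L × G | inner ℝ (p j).1 q.1 = 0} := by
      ext q
      simp only [SetLike.mem_coe, hWmem, Set.mem_inter_iff, Set.mem_iInter, Set.mem_ofPred_eq,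
        Fin.forall_iff]
    rw [this]
    exact hV.inter (isClosed_iInter fun j => isClosed_eq (by fun_prop) continuous_const)
  obtain ⟨w, hw, hw1, hmin⟩ := exists_rayleigh_minimizer hWc
    (fun R => (hc R).subset (by
      rintro u ⟨q, hq, h⟩; exact ⟨q, ((hWmem q).1 hq).1, h⟩))
    (by obtain ⟨q, hq, hq', h0⟩ := hne; exact ⟨q, (hWmem q).2 ⟨hq, hq'⟩, h0⟩)
  obtain ⟨hwV, hwo⟩ := (hWmem w).1 hw
  have hp' : ∀ i < k, Function.update p k w i = p i := fun i hi =>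
    Function.update_of_ne hi.ne _ _
  have hl' : ∀ i < k, Function.update l k (‖w.2‖ ^ 2) i = l i := fun i hi =>
    Function.update_of_ne hi.ne _ _
  have hcases : ∀ i, i < k + 1 → i < k ∨ i = k := fun i hi => by omega
  refine ⟨Function.update p k w, Function.update l k (‖w.2‖ ^ 2), ?_, ?_, ?_, ?_, ?_⟩
  · intro i hi
    rcases hcases i hi with hi | rfl
    · rw [hp' i hi]; exact h.mem i hi
    · rwa [Function.update_self]
  · intro i hi q hq
    rcases hcases i hi with hi | rfl
    · rw [hp' i hi, hl' i hi]; exact h.eig i hi q hq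
    · rw [Function.update_self, Function.update_self]
      have hq' := (hWmem _).2 ⟨h.sub_sum_mem hq fun j => inner ℝ (p j).1 q.1,
        fun j hj => h.inner_sub_sum q hj⟩
      have h1 := inner_snd_eq_of_minimizer hw hw1 hmin hq'
      rw [Prod.fst_sub, Prod.snd_sub, Prod.fst_sum, Prod.snd_sum, inner_sub_right, inner_sub_right,
        inner_sum, inner_sum, Finset.sum_eq_zero, Finset.sum_eq_zero, sub_zero, sub_zero] at h1
      · exact h1
      · intro j hj
        rw [Prod.smul_fst, inner_smul_right, real_inner_comm (p j).1 w.1, hwo j (Finset.mem_range.1 hj),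
          mul_zero]
      · intro j hj
        rw [Prod.smul_snd, inner_smul_right, real_inner_comm (p j).2 w.2,
          h.eig j (Finset.mem_range.1 hj) w hwV, hwo j (Finset.mem_range.1 hj), mul_zero, mul_zero]
  · intro i hi
    rcases hcases i hi with hi | rfl
    · rw [hp' i hi]; exact h.norm i hi
    · rwa [Function.update_self]
  · intro i hi j hj hij
    rcases hcases i hi with hi | rfl <;> rcases hcases j hj with hj | rfl
    · rw [hp' i hi, hp' j hj]; exact h.orth i hi j hj hij
    · rw [hp' i hi, Function.update_self]; exact hwo i hi
    · rw [hp' j hj, Function.update_self, real_inner_comm]; exact hwo j hj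
    · exact absurd rfl hij
  · intro i hi q hq hqo
    rcases hcases i hi with hi | rfl
    · rw [hl' i hi]
      exact h.min i hi q hq fun j hj => by rw [← hp' j (hj.trans hi)]; exact hqo j hj
    · rw [Function.update_self]
      exact hmin q ((hWmem q).2 ⟨hq, fun j hj => by rw [← hp' j hj]; exact hqo j hj⟩)

/-- An eigenvector whose eigenvalue lies below `l k` is a combination of the first `k`
eigenvectors. -/
theorem mem_span_of_lt (h : IsEigensystem V (k + 1) p l) {q : L × G} (hq : q ∈ V) {μ : ℝ}
    (hμ : ∀ r ∈ V, inner ℝ q.2 r.2 = μ * inner ℝ q.1 r.1) (hlt : μ < l k) :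
    q.1 ∈ Submodule.span ℝ (Set.range fun i : Fin k => (p i).1) := by
  have hk : IsEigensystem V k p l := h.of_le k.le_succ
  -- The component r of q orthogonal to the first k eigenvectors satisfies ‖r.2‖² = μ‖r.1‖², while
  -- minimality of `l k` forces ‖r.2‖² ≥ l k ‖r.1‖². As μ < l k, its first component is zero.
  obtain ⟨r, hr⟩ : ∃ r, r = q - ∑ i ∈ Finset.range k, inner ℝ (p i).1 q.1 • p i := ⟨_, rfl⟩
  have hrV : r ∈ V := hr ▸ hk.sub_sum_mem hq _
  have hro : ∀ j < k, inner ℝ (p j).1 r.1 = 0 := fun j hj => hr ▸ hk.inner_sub_sum q hj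
  have h1 : ‖r.2‖ ^ 2 = μ * ‖r.1‖ ^ 2 := by
    have e1 : inner ℝ r.2 r.2 = inner ℝ q.2 r.2 := by
      nth_rewrite 1 [hr]
      rw [Prod.snd_sub, Prod.snd_sum, inner_sub_left, sum_inner, Finset.sum_eq_zero, sub_zero]
      intro j hj
      rw [Prod.smul_snd, inner_smul_left, hk.eig j (Finset.mem_range.1 hj) r hrV,
        hro j (Finset.mem_range.1 hj), mul_zero, mul_zero]
    have e2 : inner ℝ r.1 r.1 = inner ℝ q.1 r.1 := by
      nth_rewrite 1 [hr]
      rw [Prod.fst_sub, Prod.fst_sum, inner_sub_left, sum_inner, Finset.sum_eq_zero, sub_zero]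
      intro j hj
      rw [Prod.smul_fst, inner_smul_left, hro j (Finset.mem_range.1 hj), mul_zero]
    rw [← real_inner_self_eq_norm_sq, ← real_inner_self_eq_norm_sq, e1, e2, hμ r hrV]
  have h2 := h.min k (by omega) r hrV hro
  have h3 : r.1 = 0 := by
    rw [← norm_eq_zero, ← sq_eq_zero_iff]
    nlinarith [sq_nonneg ‖r.1‖]
  have h4 : q.1 = ∑ i ∈ Finset.range k, inner ℝ (p i).1 q.1 • (p i).1 := by
    rw [hr, Prod.fst_sub, sub_eq_zero, Prod.fst_sum] at h3
    simpa only [Prod.smul_fst] using h3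
  rw [h4]
  refine Submodule.sum_mem _ fun i hi => Submodule.smul_mem _ _ (Submodule.subset_span ?_)
  exact ⟨⟨i, Finset.mem_range.1 hi⟩, rfl⟩

theorem linearIndependent (h : IsEigensystem V k p l) :
    LinearIndependent ℝ fun i : Fin k => (p i).1 :=
  Orthonormal.linearIndependent
    ⟨fun i => h.norm i i.2, fun i j hij => h.orth i i.2 j j.2 (by simpa [Fin.ext_iff] using hij)⟩

/-- The counting definition of the eigenvalues agrees with the variational construction. -/
theorem sInf_eq (h : IsEigensystem V (k + 1) p l) :
    sInf {t : ℝ | ∃ u : Fin (k + 1) → L, LinearIndependent ℝ u ∧ ∀ i, ∃ μ ≤ t, ∃ g,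
      (u i, g) ∈ V ∧ ∀ q ∈ V, inner ℝ g q.2 = μ * inner ℝ (u i) q.1} = l k := by
  refine IsLeast.csInf_eq ⟨?_, ?_⟩
  · refine ⟨fun i => (p i).1, h.linearIndependent, fun i => ⟨l i, ?_, (p i).2, h.mem i i.2,
      h.eig i i.2⟩⟩
    exact h.monotone (Nat.lt_succ_iff.1 i.2) (Nat.lt_succ_self k)
  -- If t < l k, all k + 1 independent eigenvectors would lie in the span of k vectors.
  · rintro t ⟨u, hu, hut⟩
    by_contra hlt
    push Not at hlt
    set S := Submodule.span ℝ (Set.range fun i : Fin k => (p i).1)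
    have hS : ∀ i, u i ∈ S := by
      intro i
      obtain ⟨μ, hμ, g, hg, hgq⟩ := hut i
      exact h.mem_span_of_lt hg hgq (hμ.trans_lt hlt)
    have hfin : Module.finrank ℝ S ≤ k := by
      have := finrank_range_le_card (R := ℝ) (fun i : Fin k => (p i).1)
      simpa [Set.finrank] using this
    have hu' : LinearIndependent ℝ (fun i => (⟨u i, hS i⟩ : S)) :=
      LinearIndependent.of_comp S.subtype hu
    have : FiniteDimensional ℝ S := FiniteDimensional.span_of_finite ℝ (Set.finite_range _)
    have := hu'.fintype_card_le_finrank
    rw [Fintype.card_fin] at this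
    omega

end IsEigensystem

/-- If a symmetric operator without eigenvectors preserves the first components of `V`, then the
variational construction never stops. -/
theorem exists_isEigensystem [CompleteSpace L] [CompleteSpace G] {V : Submodule ℝ (L × G)}
    (hV : IsClosed (V : Set (L × G)))
    (hc : ∀ R, TotallyBounded {u : L | ∃ p ∈ V, p.1 = u ∧ ‖p.1‖ ≤ R ∧ ‖p.2‖ ≤ R})
    (hne : ∃ q ∈ V, q.1 ≠ 0) (X : L →ₗ[ℝ] L) (hX : X.IsSymmetric)
    (hXV : ∀ q ∈ V, ∃ g, (X q.1, g) ∈ V) (hXe : ∀ (c : ℝ) (u : L), X u = c • u → u = 0) (k : ℕ) :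
    ∃ p l, IsEigensystem V k p l := by
  induction k with
  | zero => exact ⟨fun _ => 0, fun _ => 0, IsEigensystem.zero⟩
  | succ k ih =>
    obtain ⟨p, l, h⟩ := ih
    refine h.succ hV hc ?_
    by_contra hcon
    push Not at hcon
    -- If the process stopped, F would be finite-dimensional, nonzero and X-invariant, so the
    -- spectral theorem would give X an eigenvector in F.
    set F := V.map (LinearMap.fst ℝ L G) with hFdef
    have hFle : F ≤ Submodule.span ℝ (Set.range fun i : Fin k => (p i).1) := by
      rintro _ ⟨q, hq, rfl⟩
      have h0 := hcon _ (h.sub_sum_mem hq fun j => inner ℝ (p j).1 q.1)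
        (fun j hj => h.inner_sub_sum q hj)
      rw [Prod.fst_sub, sub_eq_zero, Prod.fst_sum] at h0
      rw [LinearMap.fst_apply, h0]
      exact Submodule.sum_mem _ fun i hi => Submodule.smul_mem _ _ (Submodule.subset_span
        ⟨⟨i, Finset.mem_range.1 hi⟩, rfl⟩)
    have : FiniteDimensional ℝ (Submodule.span ℝ (Set.range fun i : Fin k => (p i).1)) :=
      FiniteDimensional.span_of_finite ℝ (Set.finite_range _)
    have : FiniteDimensional ℝ F := Submodule.finiteDimensional_of_le hFle
    have hmaps : ∀ v ∈ F, X v ∈ F := by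
      rintro _ ⟨q, hq, rfl⟩
      obtain ⟨g, hg⟩ := hXV q hq
      exact ⟨_, hg, rfl⟩
    obtain ⟨q, hq, hq0⟩ := hne
    have : Nontrivial F := ⟨⟨⟨q.1, q, hq, rfl⟩, 0, fun h => hq0 (congrArg Subtype.val h)⟩⟩
    have hpos : 0 < Module.finrank ℝ F := Module.finrank_pos
    have hev := (hX.restrict_invariant hmaps).hasEigenvalue_eigenvalues rfl ⟨0, hpos⟩
    obtain ⟨v, hv⟩ := hev.exists_hasEigenvector
    have h1 := congrArg Subtype.val hv.apply_eq_smul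
    exact hv.2 (Subtype.ext (hXe _ v.1 h1))

end Abstract

/-! ### The Hile–Protter argument in abstract form. -/

section HileProtter

variable {L G : Type*} [NormedAddCommGroup L] [InnerProductSpace ℝ L]
  [NormedAddCommGroup G] [InnerProductSpace ℝ G]

/-- An abstract coordinate function and the associated partial derivative: `X` and `Y` stand for
the multiplication of functions and fields with a coordinate, `D` for the component of a field in
the direction of the coordinate, and `E` for the field with a given single component. -/
structure IsCoordinate (V : Submodule ℝ (L × G)) (X : L →ₗ[ℝ] L) (Y : G →ₗ[ℝ] G)
    (D : G →ₗ[ℝ] L) (E : L →ₗ[ℝ] G) : Prop where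
  symm_fst : ∀ u v, inner ℝ (X u) v = inner ℝ u (X v)
  symm_snd : ∀ g h, inner ℝ (Y g) h = inner ℝ g (Y h)
  adjoint : ∀ u g, inner ℝ (E u) g = inner ℝ u (D g)
  comp_self : ∀ u, D (E u) = u
  comm : ∀ g, D (Y g) = X (D g)
  leibniz : ∀ q ∈ V, (X q.1, Y q.2 + E q.1) ∈ V
  by_parts : ∀ q ∈ V, ∀ r ∈ V, inner ℝ (D q.2) r.1 = -inner ℝ q.1 (D r.2)

namespace IsCoordinate

variable {V : Submodule ℝ (L × G)} {X : L →ₗ[ℝ] L} {Y : G →ₗ[ℝ] G} {D : G →ₗ[ℝ] L}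
  {E : L →ₗ[ℝ] G}

/-- This is 2∫ x u ∂u = ∫ x ∂(u²) = -∫ u², in weak form. -/
theorem two_mul_inner (h : IsCoordinate V X Y D E) {q : L × G} (hq : q ∈ V) :
    2 * inner ℝ (D q.2) (X q.1) = -‖q.1‖ ^ 2 := by
  have h1 : inner ℝ (D q.2) (X q.1) = -inner ℝ q.1 (D (Y q.2 + E q.1)) :=
    h.by_parts q hq _ (h.leibniz q hq)
  have h2 := h.symm_fst q.1 (D q.2)
  rw [map_add, h.comm, h.comp_self, inner_add_right, real_inner_self_eq_norm_sq, ← h2,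
    real_inner_comm (D q.2)] at h1
  linarith

/-- The weak form of `-Δ(x u) = μ x u - 2 ∂u` for an eigenfunction `u`. -/
theorem inner_leibniz (h : IsCoordinate V X Y D E) {p q : L × G} (hp : p ∈ V) (hq : q ∈ V)
    {μ : ℝ} (hμ : ∀ r ∈ V, inner ℝ p.2 r.2 = μ * inner ℝ p.1 r.1) :
    inner ℝ (Y p.2 + E p.1) q.2 = μ * inner ℝ (X p.1) q.1 - 2 * inner ℝ (D p.2) q.1 := by
  have h1 : inner ℝ p.2 (Y q.2 + E q.1) = μ * inner ℝ p.1 (X q.1) := hμ _ (h.leibniz q hq)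
  have h2 := h.by_parts p hp q hq
  have h3 := h.adjoint q.1 p.2
  have h4 := real_inner_comm p.2 (E q.1)
  have h5 := real_inner_comm q.1 (D p.2)
  rw [inner_add_right] at h1
  rw [inner_add_left, h.symm_snd, h.adjoint, h.symm_fst]
  linarith

/-- The inequality of Hile and Protter for a single coordinate. -/
theorem natCast_le_sum (h : IsCoordinate V X Y D E) {m : ℕ} {p : ℕ → L × G} {l : ℕ → ℝ}
    (hp : IsEigensystem V (m + 1) p l) (hlt : ∀ i < m, l i < l m) :
    (m : ℝ) ≤ ∑ i ∈ Finset.range m, 4 / (l m - l i) * ‖D (p i).2‖ ^ 2 := by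
  set a : ℕ → ℕ → ℝ := fun i j => inner ℝ (p j).1 (X (p i).1) with ha
  set b : ℕ → ℕ → ℝ := fun i j => inner ℝ (D (p i).2) (p j).1 with hb
  have hmem : ∀ i < m, p i ∈ V := fun i hi => hp.mem i (by omega)
  have ha_symm : ∀ i j, a i j = a j i := fun i j => by
    simp only [ha]; rw [← h.symm_fst, real_inner_comm]
  have hb_anti : ∀ i < m, ∀ j < m, b i j = -b j i := fun i hi j hj => by
    simp only [hb]; rw [h.by_parts _ (hmem i hi) _ (hmem j hj), real_inner_comm]
  set w : ℕ → ℝ := fun i => 1 + 2 * ∑ j ∈ Finset.range m, a i j * b i j with hw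
  have hp' : IsEigensystem V m p l := hp.of_le m.le_succ
  have hwsum : ∑ i ∈ Finset.range m, w i = m := by
    -- A symmetric matrix paired with an antisymmetric one: the double sum equals its own negative.
    have hS : ∑ i ∈ Finset.range m, ∑ j ∈ Finset.range m, a i j * b i j =
        -∑ i ∈ Finset.range m, ∑ j ∈ Finset.range m, a i j * b i j := by
      nth_rewrite 1 [Finset.sum_comm]
      rw [← Finset.sum_neg_distrib]
      refine Finset.sum_congr rfl fun i hi => ?_
      rw [← Finset.sum_neg_distrib]
      refine Finset.sum_congr rfl fun j hj => ?_
      rw [ha_symm, hb_anti j (Finset.mem_range.1 hj) i (Finset.mem_range.1 hi)]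
      ring
    simp only [hw, Finset.sum_add_distrib, ← Finset.mul_sum]
    rw [show ∑ i ∈ Finset.range m, ∑ j ∈ Finset.range m, a i j * b i j = 0 by linarith]
    simp
  rw [← hwsum]
  refine Finset.sum_le_sum fun i hi => ?_
  have him := Finset.mem_range.1 hi
  have hpos : 0 < l m - l i := sub_pos.2 (hlt i him)
  set x : L × G := (X (p i).1, Y (p i).2 + E (p i).1) with hx
  have hxV : x ∈ V := h.leibniz _ (hmem i him)
  -- φ is the trial function: x u_i with its components along the first m eigenvectors removed,
  -- hence admissible for `l m`.
  obtain ⟨φ, hφ⟩ : ∃ φ, φ = x - ∑ j ∈ Finset.range m, a i j • p j := ⟨_, rfl⟩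
  have hφV : φ ∈ V := hφ ▸ hp'.sub_sum_mem hxV _
  have hφo : ∀ j < m, inner ℝ (p j).1 φ.1 = 0 := fun j hj => hφ ▸ hp'.inner_sub_sum x hj
  have e1 : inner ℝ φ.1 φ.1 = inner ℝ x.1 φ.1 := by
    nth_rewrite 1 [hφ]
    rw [Prod.fst_sub, Prod.fst_sum, inner_sub_left, sum_inner, Finset.sum_eq_zero, sub_zero]
    intro j hj
    rw [Prod.smul_fst, inner_smul_left, hφo j (Finset.mem_range.1 hj), mul_zero]
  have e2 : inner ℝ φ.2 φ.2 = inner ℝ x.2 φ.2 := by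
    nth_rewrite 1 [hφ]
    rw [Prod.snd_sub, Prod.snd_sum, inner_sub_left, sum_inner, Finset.sum_eq_zero, sub_zero]
    intro j hj
    rw [Prod.smul_snd, inner_smul_left, hp'.eig j (Finset.mem_range.1 hj) φ hφV,
      hφo j (Finset.mem_range.1 hj), mul_zero, mul_zero]
  have e3 : inner ℝ (D (p i).2) φ.1 = -(w i / 2) := by
    have h1 := h.two_mul_inner (hmem i him)
    rw [hp'.norm i him] at h1
    rw [hφ, Prod.fst_sub, Prod.fst_sum, inner_sub_right, inner_sum]
    simp only [Prod.smul_fst, inner_smul_right, hw, hx]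
    linarith
  -- By orthogonality one factor φ may be replaced by x u_i in both norms; then the equation for x
  -- u_i is tested with φ.
  have e4 : ‖φ.2‖ ^ 2 = l i * ‖φ.1‖ ^ 2 + w i := by
    rw [← real_inner_self_eq_norm_sq, ← real_inner_self_eq_norm_sq, e1, e2, hx,
      h.inner_leibniz (hmem i him) hφV (hp'.eig i him), e3]
    ring
  have e5 := hp.min m (by omega) φ hφV hφo
  have e6 : (l m - l i) * ‖φ.1‖ ^ 2 ≤ w i := by linarith
  have e7 : (w i) ^ 2 ≤ 4 * (‖D (p i).2‖ ^ 2 * ‖φ.1‖ ^ 2) := by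
    have := abs_real_inner_le_norm (D (p i).2) φ.1
    rw [e3] at this
    have := pow_le_pow_left₀ (abs_nonneg _) this 2
    rw [sq_abs, mul_pow] at this
    linarith
  have hw0 : 0 ≤ w i := le_trans (by positivity) e6
  rw [div_mul_eq_mul_div, le_div_iff₀ hpos]
  -- For w i > 0 one factor w i is cancelled from w_i²(λ_{m+1} - λ_i) ≤ 4‖∂u_i‖² w_i.
  rcases hw0.eq_or_lt with h0 | h0
  · rw [← h0, zero_mul]; positivity
  · refine le_of_mul_le_mul_left ?_ h0
    calc w i * (w i * (l m - l i)) = (w i) ^ 2 * (l m - l i) := by ring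
      _ ≤ 4 * (‖D (p i).2‖ ^ 2 * ‖φ.1‖ ^ 2) * (l m - l i) :=
        mul_le_mul_of_nonneg_right e7 hpos.le
      _ = 4 * ‖D (p i).2‖ ^ 2 * ((l m - l i) * ‖φ.1‖ ^ 2) := by ring
      _ ≤ 4 * ‖D (p i).2‖ ^ 2 * w i := mul_le_mul_of_nonneg_left e6 (by positivity)
      _ = w i * (4 * ‖D (p i).2‖ ^ 2) := by ring

end IsCoordinate

/-- The inequality of Hile and Protter. -/
theorem hileProtter {V : Submodule ℝ (L × G)} {n : ℕ} {X : Fin n → L →ₗ[ℝ] L}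
    {Y : Fin n → G →ₗ[ℝ] G} {D : Fin n → G →ₗ[ℝ] L} {E : Fin n → L →ₗ[ℝ] G}
    (h : ∀ j, IsCoordinate V (X j) (Y j) (D j) (E j))
    (hD : ∀ g, ∑ j, ‖D j g‖ ^ 2 = ‖g‖ ^ 2) {m : ℕ} {p : ℕ → L × G} {l : ℕ → ℝ}
    (hp : IsEigensystem V (m + 1) p l) (hlt : ∀ i < m, l i < l m) :
    (m : ℝ) * n / 4 ≤ ∑ i ∈ Finset.range m, l i / (l m - l i) := by
  have h1 := Finset.sum_le_sum fun j (_ : j ∈ Finset.univ) => (h j).natCast_le_sum hp hlt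
  rw [Finset.sum_const, Finset.card_univ, Fintype.card_fin, nsmul_eq_mul, Finset.sum_comm] at h1
  have h2 : ∑ i ∈ Finset.range m, ∑ j, 4 / (l m - l i) * ‖D j (p i).2‖ ^ 2 =
      4 * ∑ i ∈ Finset.range m, l i / (l m - l i) := by
    rw [Finset.mul_sum]
    refine Finset.sum_congr rfl fun i hi => ?_
    rw [← Finset.mul_sum, hD, hp.norm_snd_sq (by have := Finset.mem_range.1 hi; omega)]
    ring
  linarith

/-- The inequality of Payne, Pólya and Weinberger, from that of Hile and Protter. -/
theorem sub_le_of_hileProtter {m n : ℕ} (hm : 1 ≤ m) (hn : 1 ≤ n) {l : ℕ → ℝ}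
    (hmono : ∀ i < m, l i ≤ l (m - 1)) (hpos : ∀ i < m, 0 ≤ l i) (hlt : l (m - 1) < l m)
    (h : (m : ℝ) * n / 4 ≤ ∑ i ∈ Finset.range m, l i / (l m - l i)) :
    l m - l (m - 1) ≤ 4 / ((m : ℝ) * n) * ∑ i ∈ Finset.range m, l i := by
  have hmn : (0 : ℝ) < m * n := by
    have : 0 < m * n := Nat.mul_pos hm hn
    exact_mod_cast this
  have h1 : (l m - l (m - 1)) * ((m : ℝ) * n / 4) ≤ ∑ i ∈ Finset.range m, l i := by
    -- Multiplying by the smallest gap l m - l (m-1) bounds each quotient's contribution by l i,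
    -- since that gap is at most l m - l i.
    refine (mul_le_mul_of_nonneg_left h (sub_pos.2 hlt).le).trans ?_
    rw [Finset.mul_sum]
    refine Finset.sum_le_sum fun i hi => ?_
    have him := Finset.mem_range.1 hi
    have h2 : 0 < l m - l i := by linarith [hmono i him]
    rw [mul_div_assoc', div_le_iff₀ h2, mul_comm]
    exact mul_le_mul_of_nonneg_left (by linarith [hmono i him]) (hpos i him)
  rw [div_mul_eq_mul_div, le_div_iff₀ hmn]
  linarith

end HileProtter

/-! ### L² estimates for translates, the Poincaré inequality and mollification. -/

section Translation

/-- The weighted Cauchy–Schwarz inequality. -/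
theorem sq_integral_mul_le {α : Type*} [MeasurableSpace α] {μ : Measure α} {w f : α → ℝ}
    (hw : ∀ x, 0 ≤ w x) (h0 : Integrable w μ) (h1 : Integrable (fun x => w x * f x) μ)
    (h2 : Integrable (fun x => w x * f x ^ 2) μ) :
    (∫ x, w x * f x ∂μ) ^ 2 ≤ (∫ x, w x ∂μ) * ∫ x, w x * f x ^ 2 ∂μ := by
  -- Expand ∫ w (f - t)² ≥ 0 as a quadratic in t and use its discriminant.
  have key : ∀ t : ℝ, 0 ≤ (∫ x, w x ∂μ) * (t * t) + (-2 * ∫ x, w x * f x ∂μ) * t +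
      ∫ x, w x * f x ^ 2 ∂μ := by
    intro t
    have h : 0 ≤ ∫ x, w x * (f x - t) ^ 2 ∂μ :=
      integral_nonneg fun x => mul_nonneg (hw x) (sq_nonneg _)
    have e : ∀ x, w x * (f x - t) ^ 2 =
        (t * t) * w x + (-2 * t) * (w x * f x) + w x * f x ^ 2 := fun x => by ring
    simp only [e] at h
    rw [integral_add (f := fun x => (t * t) * w x + (-2 * t) * (w x * f x))
      ((h0.const_mul _).add (h1.const_mul _)) h2, integral_add (h0.const_mul _) (h1.const_mul _), integral_const_mul, integral_const_mul] at h
    linarith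
  have := discrim_le_zero key
  rw [discrim] at this
  nlinarith

variable {F : Type*} [NormedAddCommGroup F] [InnerProductSpace ℝ F] [FiniteDimensional ℝ F] {φ : F → ℝ}

theorem continuous_gradient (hφ : ContDiff ℝ 1 φ) : Continuous (∇ φ) :=
  (InnerProductSpace.toDual ℝ F).symm.continuous.comp (hφ.continuous_fderiv one_ne_zero)

theorem hasCompactSupport_gradient (hc : HasCompactSupport φ) : HasCompactSupport (∇ φ) :=
  (hc.fderiv ℝ).comp_left (g := (InnerProductSpace.toDual ℝ F).symm) (map_zero _)

/-- The fundamental theorem of calculus along the segment from x to x + h, then Cauchy–Schwarz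
twice: in t and for the inner product with h. -/
theorem sq_sub_le_integral_gradient (hφ : ContDiff ℝ 1 φ) (x h : F) :
    (φ (x + h) - φ x) ^ 2 ≤ ∫ t in Set.Icc (0 : ℝ) 1, ‖h‖ ^ 2 * ‖∇ φ (x + t • h)‖ ^ 2 := by
  have hgc := continuous_gradient hφ
  have hc : Continuous fun t : ℝ => inner ℝ (∇ φ (x + t • h)) h := by fun_prop
  have hd : ∀ t : ℝ, HasDerivAt (fun t : ℝ => φ (x + t • h)) (inner ℝ (∇ φ (x + t • h)) h) t := by
    intro t
    have h1 : HasDerivAt (fun t : ℝ => x + t • h) h t := by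
      simpa using ((hasDerivAt_id t).smul_const h).const_add x
    have h2 := (hφ.differentiable one_ne_zero (x + t • h)).hasGradientAt.hasFDerivAt
    exact h2.comp_hasDerivAt t h1
  have e : ∫ t in Set.Icc (0 : ℝ) 1, inner ℝ (∇ φ (x + t • h)) h = φ (x + h) - φ x := by
    rw [integral_Icc_eq_integral_Ioc, ← intervalIntegral.integral_of_le zero_le_one,
      intervalIntegral.integral_eq_sub_of_hasDerivAt (fun t _ => hd t) (hc.intervalIntegrable 0 1)]
    simp
  have hint : ∀ f : ℝ → ℝ, Continuous f → IntegrableOn f (Set.Icc (0 : ℝ) 1) :=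
    fun f hf => hf.continuousOn.integrableOn_compact isCompact_Icc
  have h1 := sq_integral_mul_le (μ := volume.restrict (Set.Icc (0 : ℝ) 1)) (w := fun _ => 1)
    (f := fun t => inner ℝ (∇ φ (x + t • h)) h) (fun _ => zero_le_one)
    (hint _ (by fun_prop)) (hint _ (by fun_prop)) (hint _ (by fun_prop))
  simp only [one_mul, e] at h1
  refine h1.trans ?_
  simp only [integral_const, MeasurableSet.univ, measureReal_restrict_apply, Set.univ_inter,
    Real.volume_real_Icc, sub_zero, zero_le_one, sup_of_le_left, smul_eq_mul, one_mul]
  refine setIntegral_mono (hint _ (by fun_prop)) (hint _ (by fun_prop)) fun t => ?_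
  have := pow_le_pow_left₀ (abs_nonneg _) (abs_real_inner_le_norm (∇ φ (x + t • h)) h) 2
  rw [sq_abs] at this
  simp only
  linarith

variable [MeasurableSpace F] [BorelSpace F]

/-- The `L²` modulus of continuity is controlled by the gradient. -/
theorem integral_sq_translate_sub_le (hφ : ContDiff ℝ 1 φ) (hc : HasCompactSupport φ) (h : F) :
    ∫ x, (φ (x + h) - φ x) ^ 2 ≤ ‖h‖ ^ 2 * ∫ x, ‖∇ φ x‖ ^ 2 := by
  have hgc := continuous_gradient hφ
  have hgi : Integrable fun x => ‖∇ φ x‖ ^ 2 :=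
    Continuous.integrable_of_hasCompactSupport (by fun_prop)
      ((hasCompactSupport_gradient hc).comp_left (g := fun v => ‖v‖ ^ 2) (by simp))
  have hcont := hφ.continuous
  rw [← integral_const_mul]
  -- Lower integrals allow Tonelli's theorem without any integrability on the product; translation
  -- invariance then removes t.
  have hle : ∫⁻ x, ENNReal.ofReal ((φ (x + h) - φ x) ^ 2) ≤
      ∫⁻ x, ENNReal.ofReal (‖h‖ ^ 2 * ‖∇ φ x‖ ^ 2) := by
    calc ∫⁻ x, ENNReal.ofReal ((φ (x + h) - φ x) ^ 2)
        ≤ ∫⁻ x, ∫⁻ t in Set.Icc (0 : ℝ) 1, ENNReal.ofReal (‖h‖ ^ 2 * ‖∇ φ (x + t • h)‖ ^ 2) := by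
          refine lintegral_mono fun x => ?_
          rw [← ofReal_integral_eq_lintegral_ofReal]
          · exact ENNReal.ofReal_le_ofReal (sq_sub_le_integral_gradient hφ x h)
          · exact Continuous.integrableOn_Icc (by fun_prop)
          · exact Filter.Eventually.of_forall fun t => by positivity
      _ = ∫⁻ t in Set.Icc (0 : ℝ) 1, ∫⁻ x, ENNReal.ofReal (‖h‖ ^ 2 * ‖∇ φ (x + t • h)‖ ^ 2) := by
          refine lintegral_lintegral_swap (Continuous.aemeasurable ?_)
          unfold Function.uncurry
          exact ENNReal.continuous_ofReal.comp (by fun_prop)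
      _ = ∫⁻ _t in Set.Icc (0 : ℝ) 1, ∫⁻ x, ENNReal.ofReal (‖h‖ ^ 2 * ‖∇ φ x‖ ^ 2) := by
          congr 1
          ext t
          exact lintegral_add_right_eq_self
            (fun x => ENNReal.ofReal (‖h‖ ^ 2 * ‖∇ φ x‖ ^ 2)) (t • h)
      _ = ∫⁻ x, ENNReal.ofReal (‖h‖ ^ 2 * ‖∇ φ x‖ ^ 2) := by simp
  rw [integral_eq_lintegral_of_nonneg_ae (Filter.Eventually.of_forall fun x => sq_nonneg _)
      (by fun_prop : Continuous fun x => (φ (x + h) - φ x) ^ 2).aestronglyMeasurable,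
    integral_eq_lintegral_of_nonneg_ae (Filter.Eventually.of_forall fun x => by positivity)
      (by fun_prop : Continuous fun x => ‖h‖ ^ 2 * ‖∇ φ x‖ ^ 2).aestronglyMeasurable]
  refine ENNReal.toReal_mono ?_ hle
  rw [← ofReal_integral_eq_lintegral_ofReal (hgi.const_mul _)
    (Filter.Eventually.of_forall fun x => by positivity)]
  exact ENNReal.ofReal_ne_top

theorem integrable_sq_of_hasCompactSupport (hφ : Continuous φ) (hc : HasCompactSupport φ) :
    Integrable fun x => φ x ^ 2 :=
  Continuous.integrable_of_hasCompactSupport (by fun_prop)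
    (hc.comp_left (g := fun v => v ^ 2) (by simp))

/-- The Poincaré inequality for functions supported in a bounded set. -/
theorem exists_poincare [Nontrivial F] {Ω : Set F} (hΩ : Bornology.IsBounded Ω) :
    ∃ C > 0, ∀ φ : F → ℝ, ContDiff ℝ 1 φ → HasCompactSupport φ → tsupport φ ⊆ Ω →
      ∫ x, φ x ^ 2 ≤ C * ∫ x, ‖∇ φ x‖ ^ 2 := by
  obtain ⟨R, hR⟩ := Metric.isBounded_iff.1 hΩ
  -- A translation longer than the diameter makes φ and its translate disjointly supported, so the
  -- left side of the translation estimate becomes 2∫φ².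
  obtain ⟨h, hh⟩ := exists_norm_eq F (show (0 : ℝ) ≤ |R| + 1 by positivity)
  refine ⟨‖h‖ ^ 2 / 2, by rw [hh]; positivity, fun φ hφ hc hs => ?_⟩
  have h1 := integral_sq_translate_sub_le hφ hc h
  have hz : ∀ x, φ (x + h) * φ x = 0 := by
    intro x
    by_contra hne
    obtain ⟨a, b⟩ := mul_ne_zero_iff.1 hne
    have := hR (hs (subset_tsupport _ a)) (hs (subset_tsupport _ b))
    rw [dist_eq_norm, add_sub_cancel_left, hh] at this
    linarith [le_abs_self R]
  have hi := integrable_sq_of_hasCompactSupport hφ.continuous hc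
  have e : ∀ x, (φ (x + h) - φ x) ^ 2 = φ (x + h) ^ 2 + φ x ^ 2 := fun x => by
    linear_combination -2 * hz x
  simp only [e] at h1
  rw [integral_add (hi.comp_add_right h) hi,
    integral_add_right_eq_self (fun x => φ x ^ 2) h] at h1
  linarith

open scoped Pointwise in
/-- Mollification at scale `δ` moves a function by at most `δ ‖∇φ‖` in `L²`. -/
theorem integral_sq_sub_mollify_le (hφ : ContDiff ℝ 1 φ) (hc : HasCompactSupport φ) {ρ : F → ℝ}
    (hρ : Continuous ρ) (hρ0 : ∀ x, 0 ≤ ρ x) (hρ1 : ∫ x, ρ x = 1) {δ : ℝ}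
    (hρs : tsupport ρ ⊆ Metric.closedBall 0 δ) :
    Integrable (fun x => (∫ h, ρ h * (φ (x + h) - φ x)) ^ 2) ∧
    ∫ x, (∫ h, ρ h * (φ (x + h) - φ x)) ^ 2 ≤ δ ^ 2 * ∫ x, ‖∇ φ x‖ ^ 2 := by
  have hρc : HasCompactSupport ρ :=
    HasCompactSupport.of_support_subset_isCompact (isCompact_closedBall 0 δ)
      ((subset_tsupport ρ).trans hρs)
  have hcont := hφ.continuous
  have hint : ∀ f : F → ℝ, Continuous f → Integrable fun h => ρ h * f h := fun f hf =>
    (hρ.mul hf).integrable_of_hasCompactSupport hρc.mul_right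
  set H : F → F → ℝ := fun x h => ρ h * (φ (x + h) - φ x) ^ 2 with hH
  have hHcont : Continuous (Function.uncurry H) := by
    unfold Function.uncurry
    simp only [hH]
    fun_prop
  have hHs : HasCompactSupport (Function.uncurry H) := by
    refine HasCompactSupport.of_support_subset_isCompact
      (K := (tsupport φ ∪ (tsupport φ + Metric.closedBall 0 δ)) ×ˢ Metric.closedBall 0 δ)
      ((hc.isCompact.union (hc.isCompact.add (isCompact_closedBall 0 δ))).prod
        (isCompact_closedBall 0 δ)) ?_
    rintro ⟨x, h⟩ hxh
    have hxh' : ρ h * (φ (x + h) - φ x) ^ 2 ≠ 0 := hxh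
    have h1 : ρ h ≠ 0 := left_ne_zero_of_mul hxh'
    have hh : h ∈ Metric.closedBall (0 : F) δ := hρs (subset_tsupport _ h1)
    refine ⟨?_, hh⟩
    by_cases h2 : φ x = 0
    · right
      have h3 : φ (x + h) ≠ 0 := fun h3 => hxh' (by rw [h2, h3]; simp)
      refine ⟨x + h, subset_tsupport _ h3, -h, by simpa using hh, by simp⟩
    · exact Or.inl (subset_tsupport _ h2)
  -- Cauchy–Schwarz for the probability density ρ moves the square inside the average.
  have hle : ∀ x, (∫ h, ρ h * (φ (x + h) - φ x)) ^ 2 ≤ ∫ h, H x h := fun x => by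
    have := sq_integral_mul_le (f := fun h => φ (x + h) - φ x) hρ0
      (hρ.integrable_of_hasCompactSupport hρc) (hint _ (by fun_prop)) (hint _ (by fun_prop))
    rwa [hρ1, one_mul] at this
  have hHint : Integrable (fun x => ∫ h, H x h) :=
    (hHcont.integrable_of_hasCompactSupport (μ := volume.prod volume) hHs).integral_prod_left
  have hI : Integrable (fun x => (∫ h, ρ h * (φ (x + h) - φ x)) ^ 2) := by
    refine hHint.mono' ?_ (Filter.Eventually.of_forall fun x => ?_)
    · refine AEStronglyMeasurable.pow ?_ 2
      have : StronglyMeasurable (Function.uncurry fun x h => ρ h * (φ (x + h) - φ x)) := by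
        refine Continuous.stronglyMeasurable ?_
        unfold Function.uncurry
        fun_prop
      exact this.integral_prod_right.aestronglyMeasurable
    · rw [Real.norm_eq_abs, abs_of_nonneg (sq_nonneg _)]
      exact hle x
  refine ⟨hI, (integral_mono hI hHint hle).trans ?_⟩
  rw [integral_integral_swap_of_hasCompactSupport hHcont hHs]
  have hB : 0 ≤ ∫ x, ‖∇ φ x‖ ^ 2 := integral_nonneg fun x => by positivity
  calc ∫ h, ∫ x, H x h ≤ ∫ h, ρ h * (δ ^ 2 * ∫ x, ‖∇ φ x‖ ^ 2) := by
        refine integral_mono ?_ ((hρ.integrable_of_hasCompactSupport hρc).mul_const _) fun h => ?_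
        · exact (hHcont.integrable_of_hasCompactSupport
            (μ := volume.prod volume) hHs).integral_prod_right
        · simp only [hH]
          rw [integral_const_mul]
          by_cases h0 : ρ h = 0
          · simp [h0]
          · have hh : h ∈ Metric.closedBall (0 : F) δ := hρs (subset_tsupport _ h0)
            rw [mem_closedBall_zero_iff] at hh
            refine mul_le_mul_of_nonneg_left ?_ (hρ0 h)
            exact (integral_sq_translate_sub_le hφ hc h).trans
              (mul_le_mul_of_nonneg_right (pow_le_pow_left₀ (norm_nonneg _) hh 2) hB)
    _ = δ ^ 2 * ∫ x, ‖∇ φ x‖ ^ 2 := by rw [integral_mul_const, hρ1, one_mul]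

end Translation

/-! ### The Friedrichs inequality by mollification and a finite net. -/

section Friedrichs

variable {F : Type*} [NormedAddCommGroup F] [InnerProductSpace ℝ F] [FiniteDimensional ℝ F]
  [MeasurableSpace F] [BorelSpace F]

/-- The Friedrichs inequality: up to finitely many linear functionals, the `L²` norm is bounded by
an arbitrarily small multiple of the norm of the gradient. -/
theorem exists_friedrichs {Ω : Set F} (hΩ : Bornology.IsBounded Ω) (hm : MeasurableSet Ω) {ε : ℝ}
    (hε : 0 < ε) :
    ∃ (N : ℕ) (f : Fin N → F → ℝ), (∀ j, Continuous (f j)) ∧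
      ∀ φ : F → ℝ, ContDiff ℝ 1 φ → HasCompactSupport φ → tsupport φ ⊆ Ω →
        √(∫ x, φ x ^ 2) ≤ ε * √(∫ x, ‖∇ φ x‖ ^ 2) + ∑ j, |∫ x, f j x * φ x| := by
  set M : ℝ := volume.real Ω with hM
  have hM0 : 0 ≤ M := measureReal_nonneg
  have hMfin : volume Ω ≠ ∞ := hΩ.measure_lt_top.ne
  set δ : ℝ := ε / 2 with hδ
  have hδ0 : 0 < δ := by positivity
  let bump : ContDiffBump (0 : F) := ⟨δ / 2, δ, by positivity, by linarith⟩
  set ρ : F → ℝ := bump.normed volume with hρdef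
  have hρ : Continuous ρ := bump.continuous_normed
  have hρ0 : ∀ x, 0 ≤ ρ x := fun x => bump.nonneg_normed x
  have hρ1 : ∫ x, ρ x = 1 := bump.integral_normed
  have hρs : tsupport ρ ⊆ Metric.closedBall 0 δ := bump.tsupport_normed_eq.subset
  have hρc : HasCompactSupport ρ := bump.hasCompactSupport_normed
  -- With this η the error term 4M²η²A is at most A/2 and can be absorbed into the left side;
  -- doubling then produces the constants 8M and 4δ² = ε².
  obtain ⟨η, hη0, hη⟩ : ∃ η > (0 : ℝ), 8 * M ^ 2 * η ^ 2 ≤ 1 := by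
    refine ⟨1 / (4 * (M + 1)), by positivity, ?_⟩
    rw [div_pow, mul_div_assoc', div_le_one (by positivity)]
    nlinarith
  obtain ⟨r, hr0, hr⟩ := Metric.uniformContinuous_iff.1 
    (hρc.uniformContinuous_of_continuous hρ) η hη0
  obtain ⟨t, ht, htΩ⟩ := Metric.totallyBounded_iff.1
    (hΩ.isCompact_closure.totallyBounded.subset subset_closure) r hr0
  -- On the finite r-net y, the functionals φ ↦ ∫ ρ(z - y_j) φ(z) control the mollified function
  -- throughout Ω up to η‖φ‖_{L¹}.
  obtain ⟨N, y, -, rfl⟩ := ht.fin_param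
  refine ⟨N, fun j x => √(8 * M) * ρ (x - y j), fun j => by fun_prop, fun φ hφ hc hs => ?_⟩
  have hcont := hφ.continuous
  have hzero : ∀ x, x ∉ Ω → φ x = 0 := fun x hx =>
    image_eq_zero_of_notMem_tsupport fun h => hx (hs h)
  have hint : ∀ f : F → ℝ, Continuous f → Integrable fun x => f x * φ x := fun f hf =>
    (hf.mul hcont).integrable_of_hasCompactSupport hc.mul_left
  set A := ∫ x, φ x ^ 2 with hA
  set B := ∫ x, ‖∇ φ x‖ ^ 2 with hB
  set S := ∑ j, |∫ x, ρ (x - y j) * φ x| with hS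
  have hA0 : 0 ≤ A := integral_nonneg fun x => sq_nonneg _
  have hB0 : 0 ≤ B := integral_nonneg fun x => by positivity
  have hS0 : 0 ≤ S := Finset.sum_nonneg fun _ _ => abs_nonneg _
  have hφ2 := integrable_sq_of_hasCompactSupport hcont hc
  have hφ1 : Integrable φ := hcont.integrable_of_hasCompactSupport hc
  obtain ⟨hvi, hv⟩ := integral_sq_sub_mollify_le hφ hc hρ hρ0 hρ1 hρs
  set v : F → ℝ := fun x => ∫ h, ρ h * (φ (x + h) - φ x) with hvdef
  change Integrable (fun x => v x ^ 2) volume at hvi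
  change ∫ x, v x ^ 2 ≤ δ ^ 2 * B at hv
  have hconv : ∀ x, φ x = (∫ z, ρ (z - x) * φ z) - v x := by
    intro x
    have e1 : ∫ z, ρ (z - x) * φ z = ∫ h, ρ h * φ (x + h) := by
      rw [← integral_add_right_eq_self (fun z => ρ (z - x) * φ z) x]
      simp only [add_sub_cancel_right, add_comm x]
    have hi : ∀ f : F → ℝ, Continuous f → Integrable fun h => ρ h * f h := fun f hf =>
      (hρ.mul hf).integrable_of_hasCompactSupport hρc.mul_right
    simp only [hvdef, mul_sub]
    rw [integral_sub (hi _ (by fun_prop)) (hi _ (by fun_prop)), integral_mul_const, hρ1, e1]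
    ring
  have hL1 : (∫ x, |φ x|) ^ 2 ≤ M * A := by
    have hc1 : IntegrableOn (fun _ : F => (1 : ℝ)) Ω := integrableOn_const hMfin
    have h1 := sq_integral_mul_le (μ := volume.restrict Ω) (w := fun _ => 1) (f := fun x => |φ x|)
      (fun _ => zero_le_one) hc1
      (by simp only [one_mul]; exact hφ1.abs.integrableOn)
      (by simp only [one_mul, sq_abs]; exact hφ2.integrableOn)
    simp only [one_mul, sq_abs, integral_const, MeasurableSet.univ, measureReal_restrict_apply,
      Set.univ_inter, smul_eq_mul, mul_one] at h1
    rwa [setIntegral_eq_integral_of_forall_compl_eq_zero (fun x hx => by rw [hzero x hx, abs_zero]),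
      setIntegral_eq_integral_of_forall_compl_eq_zero
        (fun x hx => by rw [hzero x hx]; norm_num)] at h1
  set I := ∫ x, |φ x| with hI
  have hI0 : 0 ≤ I := integral_nonneg fun x => abs_nonneg _
  have hpt : ∀ x ∈ Ω, |∫ z, ρ (z - x) * φ z| ≤ S + η * I := by
    intro x hx
    obtain ⟨_, ⟨j, rfl⟩, hj⟩ := Set.mem_iUnion₂.1 (htΩ hx)
    have e : ∫ z, ρ (z - x) * φ z =
        (∫ z, ρ (z - y j) * φ z) + ∫ z, (ρ (z - x) - ρ (z - y j)) * φ z := by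
      rw [← integral_add (hint _ (by fun_prop)) (hint _ (by fun_prop))]
      congr 1
      ext z
      ring
    rw [e]
    refine (abs_add_le _ _).trans (add_le_add ?_ ?_)
    · exact Finset.single_le_sum (f := fun j => |∫ x, ρ (x - y j) * φ x|)
        (fun _ _ => abs_nonneg _) (Finset.mem_univ j)
    · refine (abs_integral_le_integral_abs).trans ?_
      rw [hI, ← integral_const_mul]
      refine integral_mono (hint _ (by fun_prop)).abs (hφ1.abs.const_mul _) fun z => ?_
      simp only [abs_mul]
      refine mul_le_mul_of_nonneg_right (le_of_lt ?_) (abs_nonneg _)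
      have := hr (a := z - x) (b := z - y j) (by
        rw [dist_sub_left]; exact Metric.mem_ball.1 hj)
      rwa [Real.dist_eq] at this
  have hmain : A ≤ 2 * (M * (S + η * I) ^ 2) + 2 * (δ ^ 2 * B) := by
    have h1 : A = ∫ x in Ω, φ x ^ 2 := by
      rw [setIntegral_eq_integral_of_forall_compl_eq_zero (fun x hx => by rw [hzero x hx]; norm_num)]
    have h2 : ∫ x in Ω, φ x ^ 2 ≤ ∫ x in Ω, (2 * (S + η * I) ^ 2 + 2 * v x ^ 2) := by
      refine setIntegral_mono_on hφ2.integrableOn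
        ((integrableOn_const hMfin).add (hvi.integrableOn.const_mul 2)) hm fun x hx => ?_
      have h3 := hpt x hx
      have h4 := pow_le_pow_left₀ (abs_nonneg _) h3 2
      rw [sq_abs] at h4
      rw [hconv x]
      nlinarith [sq_nonneg ((∫ z, ρ (z - x) * φ z) + v x)]
    have h3 : ∫ x in Ω, v x ^ 2 ≤ ∫ x, v x ^ 2 :=
      setIntegral_le_integral hvi (Filter.Eventually.of_forall fun x => sq_nonneg _)
    have hc2 : IntegrableOn (fun _ : F => 2 * (S + η * I) ^ 2) Ω := integrableOn_const hMfin
    rw [integral_add hc2 (hvi.integrableOn.const_mul 2),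
      setIntegral_const, integral_const_mul 2 fun x => v x ^ 2, smul_eq_mul, ← hM] at h2
    linarith
  have hsq : A ≤ (ε * √B + √(8 * M) * S) ^ 2 := by
    have h1 : A ≤ 4 * δ ^ 2 * B + 8 * M * S ^ 2 := by
      have h2 : (S + η * I) ^ 2 ≤ 2 * S ^ 2 + 2 * (η ^ 2 * I ^ 2) := by
        nlinarith [sq_nonneg (S - η * I)]
      have h3 := mul_le_mul_of_nonneg_left h2 hM0
      have h4 : M * (η ^ 2 * I ^ 2) ≤ M * (η ^ 2 * (M * A)) := by gcongr
      have h5 : 8 * M ^ 2 * η ^ 2 * A ≤ 1 * A := mul_le_mul_of_nonneg_right hη hA0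
      nlinarith
    have h2 : (ε * √B + √(8 * M) * S) ^ 2 =
        ε ^ 2 * B + 8 * M * S ^ 2 + 2 * (ε * √B * (√(8 * M) * S)) := by
      rw [add_sq, mul_pow, mul_pow, Real.sq_sqrt hB0, Real.sq_sqrt (by positivity)]
      ring
    have h3 : 4 * δ ^ 2 * B = ε ^ 2 * B := by rw [hδ]; ring
    have h4 : 0 ≤ ε * √B * (√(8 * M) * S) := by positivity
    linarith
  have hfin : ∑ j, |∫ x, √(8 * M) * ρ (x - y j) * φ x| = √(8 * M) * S := by
    rw [hS, Finset.mul_sum]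
    refine Finset.sum_congr rfl fun j _ => ?_
    simp only [mul_assoc]
    rw [integral_const_mul, abs_mul, abs_of_nonneg (Real.sqrt_nonneg _)]
  rw [hfin]
  exact Real.sqrt_le_iff.2 ⟨by positivity, hsq⟩

end Friedrichs

/-! ### Test functions and the passage of the inequalities to H¹₀(Ω). -/

section TestFunctions

variable {n : ℕ} {Ω : Set (EuclideanSpace ℝ (Fin n))} {φ ψ : EuclideanSpace ℝ (Fin n) → ℝ}

theorem gradient_coord_apply (φ : EuclideanSpace ℝ (Fin n) → ℝ) (x : EuclideanSpace ℝ (Fin n))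
    (j : Fin n) : (∇ φ x) j = fderiv ℝ φ x (EuclideanSpace.single j 1) := by
  have h1 := InnerProductSpace.toDual_symm_apply (x := EuclideanSpace.single j (1 : ℝ))
    (y := fderiv ℝ φ x)
  rw [EuclideanSpace.inner_single_right] at h1
  rw [gradient, ← h1]
  simp

namespace IsTestFunction

theorem contDiff_one (h : IsTestFunction Ω φ) : ContDiff ℝ 1 φ :=
  h.1.of_le (by exact_mod_cast le_top)

theorem differentiable (h : IsTestFunction Ω φ) : Differentiable ℝ φ :=
  h.contDiff_one.differentiable one_ne_zero

theorem continuous (h : IsTestFunction Ω φ) : Continuous φ := h.1.continuous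

theorem eq_zero (h : IsTestFunction Ω φ) {x : EuclideanSpace ℝ (Fin n)} (hx : x ∉ Ω) : φ x = 0 :=
  image_eq_zero_of_notMem_tsupport fun hx' => hx (h.2.2 hx')

theorem gradient_eq_zero (h : IsTestFunction Ω φ) {x : EuclideanSpace ℝ (Fin n)} (hx : x ∉ Ω) :
    ∇ φ x = 0 := by
  have : fderiv ℝ φ x = 0 :=
    image_eq_zero_of_notMem_tsupport fun hx' => hx (h.2.2 (tsupport_fderiv_subset ℝ hx'))
  rw [gradient, this, map_zero]

theorem zero : IsTestFunction Ω 0 :=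
  ⟨contDiff_const, HasCompactSupport.zero, by simp [tsupport]⟩

theorem add (hφ : IsTestFunction Ω φ) (hψ : IsTestFunction Ω ψ) : IsTestFunction Ω (φ + ψ) :=
  ⟨hφ.1.add hψ.1, hφ.2.1.add hψ.2.1, (tsupport_add φ ψ).trans (Set.union_subset hφ.2.2 hψ.2.2)⟩

theorem mul_left (hφ : IsTestFunction Ω φ) (hψ : ContDiff ℝ ((⊤ : ℕ∞) : WithTop ℕ∞) ψ) :
    IsTestFunction Ω (fun x => ψ x * φ x) :=
  ⟨hψ.mul hφ.1, hφ.2.1.mul_left, (tsupport_mul_subset_right).trans hφ.2.2⟩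

theorem gradient_add (hφ : IsTestFunction Ω φ) (hψ : IsTestFunction Ω ψ)
    (x : EuclideanSpace ℝ (Fin n)) : ∇ (φ + ψ) x = ∇ φ x + ∇ ψ x := by
  rw [gradient, gradient, gradient, fderiv_add (hφ.differentiable x) (hψ.differentiable x), map_add]

theorem gradient_const_mul (hφ : IsTestFunction Ω φ) (c : ℝ) (x : EuclideanSpace ℝ (Fin n)) :
    ∇ (fun x => c * φ x) x = c • ∇ φ x := by
  rw [gradient, gradient, fderiv_const_mul (hφ.differentiable x), map_smul]

theorem gradient_coord_mul (hφ : IsTestFunction Ω φ) (j : Fin n) (x : EuclideanSpace ℝ (Fin n)) :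
    ∇ (fun x : EuclideanSpace ℝ (Fin n) => x j * φ x) x =
      x j • ∇ φ x + φ x • EuclideanSpace.single j (1 : ℝ) := by
  have hp : HasFDerivAt (fun x : EuclideanSpace ℝ (Fin n) => x j)
      (EuclideanSpace.proj j : EuclideanSpace ℝ (Fin n) →L[ℝ] ℝ) x :=
    (EuclideanSpace.proj (𝕜 := ℝ) j).hasFDerivAt
  have h := (hp.mul (hφ.differentiable x).hasFDerivAt).fderiv
  ext i
  rw [gradient_coord_apply]
  change fderiv ℝ ((fun x : EuclideanSpace ℝ (Fin n) => x j) * φ) x _ = _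
  rw [h]
  simp [gradient_coord_apply, eq_comm]

theorem gradient_continuous (hφ : IsTestFunction Ω φ) : Continuous (∇ φ) :=
  continuous_gradient hφ.contDiff_one

theorem integral_mul_gradient (hφ : IsTestFunction Ω φ) (hψ : IsTestFunction Ω ψ) (j : Fin n) :
    ∫ x, φ x * (∇ ψ x) j = -∫ x, (∇ φ x) j * ψ x := by
  have hgφ := hφ.gradient_continuous
  have hgψ := hψ.gradient_continuous
  have hc1 := hφ.continuous
  have hc2 := hψ.continuous
  simp only [gradient_coord_apply] at *
  refine integral_mul_fderiv_eq_neg_fderiv_mul_of_integrable ?_ ?_ ?_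
    (fun x _ => hφ.differentiable x) fun x _ => hψ.differentiable x
  · simp only [← gradient_coord_apply]
    exact Continuous.integrable_of_hasCompactSupport (by fun_prop) hψ.2.1.mul_left
  · simp only [← gradient_coord_apply]
    exact Continuous.integrable_of_hasCompactSupport (by fun_prop) hφ.2.1.mul_right
  · exact Continuous.integrable_of_hasCompactSupport (by fun_prop) hφ.2.1.mul_right

theorem memLp (hφ : IsTestFunction Ω φ) : MemLp φ 2 (volume.restrict Ω) :=
  hφ.continuous.memLp_of_hasCompactSupport hφ.2.1

theorem memLp_gradient (hφ : IsTestFunction Ω φ) : MemLp (∇ φ) 2 (volume.restrict Ω) :=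
  hφ.gradient_continuous.memLp_of_hasCompactSupport (hasCompactSupport_gradient hφ.2.1)

theorem mem_testPairs (hφ : IsTestFunction Ω φ) :
    (hφ.memLp.toLp φ, hφ.memLp_gradient.toLp (∇ φ)) ∈ testPairs Ω :=
  ⟨φ, hφ, hφ.memLp.coeFn_toLp, hφ.memLp_gradient.coeFn_toLp⟩

end IsTestFunction

/-- `H¹₀(Ω)` as a submodule. -/
noncomputable def sobolevSubmodule (Ω : Set (EuclideanSpace ℝ (Fin n))) :
    Submodule ℝ (L2Fun Ω × L2Field Ω) :=
  Submodule.topologicalClosure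
    { carrier := testPairs Ω
      zero_mem' := by
        refine ⟨0, IsTestFunction.zero, Lp.coeFn_zero _ _ _, ?_⟩
        have : ∇ (0 : EuclideanSpace ℝ (Fin n) → ℝ) = 0 := by
          ext x
          simp [gradient]
        rw [this]
        exact Lp.coeFn_zero _ _ _
      add_mem' := by
        rintro p q ⟨φ, hφ, h1, h2⟩ ⟨ψ, hψ, h3, h4⟩
        refine ⟨φ + ψ, hφ.add hψ, ?_, ?_⟩
        · filter_upwards [h1, h3, Lp.coeFn_add p.1 q.1] with x a b c
          rw [Prod.fst_add, c, Pi.add_apply, Pi.add_apply, a, b]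
        · filter_upwards [h2, h4, Lp.coeFn_add p.2 q.2] with x a b c
          rw [Prod.snd_add, c, Pi.add_apply, a, b, hφ.gradient_add hψ]
      smul_mem' := by
        rintro c p ⟨φ, hφ, h1, h2⟩
        refine ⟨fun x => c * φ x, hφ.mul_left contDiff_const, ?_, ?_⟩
        · filter_upwards [h1, Lp.coeFn_smul c p.1] with x a b
          rw [Prod.smul_fst, b, Pi.smul_apply, a, smul_eq_mul]
        · filter_upwards [h2, Lp.coeFn_smul c p.2] with x a b
          rw [Prod.smul_snd, b, Pi.smul_apply, a, hφ.gradient_const_mul] }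

theorem isClosed_sobolevSubmodule (Ω : Set (EuclideanSpace ℝ (Fin n))) :
    IsClosed (sobolevSubmodule Ω : Set (L2Fun Ω × L2Field Ω)) := isClosed_closure

theorem norm_sq_eq_integral {E : Type*} [NormedAddCommGroup E] [InnerProductSpace ℝ E]
    {α : Type*} [MeasurableSpace α] {μ : Measure α} (u : Lp E 2 μ) :
    ‖u‖ ^ 2 = ∫ x, ‖u x‖ ^ 2 ∂μ := by
  rw [← real_inner_self_eq_norm_sq, L2.inner_def]
  simp only [real_inner_self_eq_norm_sq]

theorem norm_sq_fst_eq {p : L2Fun Ω × L2Field Ω} (hφ : IsTestFunction Ω φ)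
    (h : p.1 =ᵐ[volume.restrict Ω] φ) : ‖p.1‖ ^ 2 = ∫ x, φ x ^ 2 := by
  rw [norm_sq_eq_integral, ← setIntegral_eq_integral_of_forall_compl_eq_zero (s := Ω)
    (f := fun x => φ x ^ 2) fun x hx => by rw [hφ.eq_zero hx]; norm_num]
  refine integral_congr_ae ?_
  filter_upwards [h] with x hx
  rw [hx, Real.norm_eq_abs, sq_abs]

theorem norm_sq_snd_eq {p : L2Fun Ω × L2Field Ω} (hφ : IsTestFunction Ω φ)
    (h : p.2 =ᵐ[volume.restrict Ω] ∇ φ) : ‖p.2‖ ^ 2 = ∫ x, ‖∇ φ x‖ ^ 2 := by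
  rw [norm_sq_eq_integral, ← setIntegral_eq_integral_of_forall_compl_eq_zero (s := Ω)
    (f := fun x => ‖∇ φ x‖ ^ 2) fun x hx => by rw [hφ.gradient_eq_zero hx]; norm_num]
  refine integral_congr_ae ?_
  filter_upwards [h] with x hx
  rw [hx]

/-- The Poincaré inequality on `H¹₀(Ω)`. -/
theorem exists_poincare_H10 (hn : 1 ≤ n) (hΩ : Bornology.IsBounded Ω) :
    ∃ C > 0, ∀ p ∈ H10 Ω, ‖p.1‖ ^ 2 ≤ C * ‖p.2‖ ^ 2 := by
  have : Nonempty (Fin n) := ⟨⟨0, hn⟩⟩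
  obtain ⟨C, hC, h⟩ := exists_poincare hΩ
  refine ⟨C, hC, fun p hp => ?_⟩
  -- The inequality is a closed condition on pairs, so it suffices to check it on test functions.
  refine closure_minimal (t := {p | ‖p.1‖ ^ 2 ≤ C * ‖p.2‖ ^ 2}) ?_
    (isClosed_le (by fun_prop) (by fun_prop)) hp
  rintro p ⟨φ, hφ, h1, h2⟩
  change ‖p.1‖ ^ 2 ≤ C * ‖p.2‖ ^ 2
  rw [norm_sq_fst_eq hφ h1, norm_sq_snd_eq hφ h2]
  exact h φ hφ.contDiff_one hφ.2.1 hφ.2.2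

/-- The Friedrichs inequality on `H¹₀(Ω)`. -/
theorem exists_friedrichs_H10 (hΩ : Bornology.IsBounded Ω) (hm : MeasurableSet Ω) {ε : ℝ}
    (hε : 0 < ε) : ∃ (N : ℕ) (f : Fin N → L2Fun Ω), ∀ p ∈ H10 Ω,
      ‖p.1‖ ≤ ε * ‖p.2‖ + ∑ j, |inner ℝ (f j) p.1| := by
  obtain ⟨N, f, hf, h⟩ := exists_friedrichs hΩ hm hε
  have hfm : ∀ j, MemLp (f j) 2 (volume.restrict Ω) := fun j => by
    obtain ⟨C, hC⟩ := hΩ.isCompact_closure.exists_bound_of_continuousOn (hf j).continuousOn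
    have : IsFiniteMeasure (volume.restrict Ω) :=
      isFiniteMeasure_restrict.2 hΩ.measure_lt_top.ne
    refine MemLp.of_bound (hf j).aestronglyMeasurable C ?_
    filter_upwards [ae_restrict_mem hm] with x hx
    exact hC x (subset_closure hx)
  refine ⟨N, fun j => (hfm j).toLp (f j), fun p hp => ?_⟩
  refine closure_minimal
    (t := {p | ‖p.1‖ ≤ ε * ‖p.2‖ + ∑ j, |inner ℝ ((hfm j).toLp (f j)) p.1|}) ?_
    (isClosed_le (by fun_prop) (by fun_prop)) hp
  rintro p ⟨φ, hφ, h1, h2⟩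
  change ‖p.1‖ ≤ ε * ‖p.2‖ + ∑ j, |inner ℝ ((hfm j).toLp (f j)) p.1|
  rw [← Real.sqrt_sq (norm_nonneg p.1), ← Real.sqrt_sq (norm_nonneg p.2), norm_sq_fst_eq hφ h1,
    norm_sq_snd_eq hφ h2]
  refine (h φ hφ.contDiff_one hφ.2.1 hφ.2.2).trans_eq ?_
  congr 2
  ext j
  congr 1
  rw [L2.inner_def, ← setIntegral_eq_integral_of_forall_compl_eq_zero (s := Ω)
    (f := fun x => f j x * φ x) fun x hx => by rw [hφ.eq_zero hx, mul_zero]]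
  refine integral_congr_ae ?_
  filter_upwards [h1, (hfm j).coeFn_toLp] with x a b
  rw [a, b]
  simp [mul_comm]

/-- Rellich's theorem: sets of functions bounded in `H¹₀(Ω)` are totally bounded in `L²(Ω)`. -/
theorem totallyBounded_fst_H10 (hΩ : Bornology.IsBounded Ω) (hm : MeasurableSet Ω) (R : ℝ) :
    TotallyBounded
      {u : L2Fun Ω | ∃ p ∈ sobolevSubmodule Ω, p.1 = u ∧ ‖p.1‖ ≤ R ∧ ‖p.2‖ ≤ R} := by
  refine totallyBounded_fst_of_friedrichs (V := {p | p ∈ sobolevSubmodule Ω}) (fun ε hε => ?_) R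
  obtain ⟨N, f, h⟩ := exists_friedrichs_H10 hΩ hm hε
  refine ⟨N, f, fun p hp q hq => ?_⟩
  have h1 := h (p - q) ((sobolevSubmodule Ω).sub_mem hp hq)
  rwa [Prod.fst_sub, Prod.snd_sub] at h1

theorem exists_fst_ne_zero (hΩ : IsOpen Ω) (hne : Ω.Nonempty) :
    ∃ q ∈ sobolevSubmodule Ω, q.1 ≠ 0 := by
  obtain ⟨x, hx⟩ := hne
  obtain ⟨φ, hs, hc, hd, -, h1⟩ := exists_contDiff_tsupport_subset (n := ⊤) (hΩ.mem_nhds hx)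
  have hφ : IsTestFunction Ω φ := ⟨hd, hc, hs⟩
  refine ⟨_, subset_closure hφ.mem_testPairs, fun h0 => ?_⟩
  have h2 := norm_sq_fst_eq (p := (hφ.memLp.toLp φ, hφ.memLp_gradient.toLp (∇ φ))) hφ
    hφ.memLp.coeFn_toLp
  rw [h0, norm_zero] at h2
  have h3 : 0 < ∫ x, φ x ^ 2 := by
    refine Continuous.integral_pos_of_hasCompactSupport_nonneg_nonzero (x := x)
      (by have := hφ.continuous; fun_prop) (hc.comp_left (g := fun v => v ^ 2) (by simp))
      (fun x => sq_nonneg _) (by simp [h1])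
  norm_num at h2
  linarith

end TestFunctions

/-! ### Coordinate multiplication and partial derivatives on L²(Ω). -/

section Coordinates

variable {n : ℕ} {Ω : Set (EuclideanSpace ℝ (Fin n))}

/-- Multiplication with a coordinate as an operator on `L²(Ω)`. -/
theorem exists_coord_mul (hΩ : Bornology.IsBounded Ω) (hm : MeasurableSet Ω) (j : Fin n)
    (E : Type*) [NormedAddCommGroup E] [NormedSpace ℝ E] :
    ∃ X : Lp E 2 (volume.restrict Ω) →L[ℝ] Lp E 2 (volume.restrict Ω),
      ∀ u, X u =ᵐ[volume.restrict Ω] fun x => x j • u x := by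
  obtain ⟨C, hC⟩ := hΩ.exists_norm_le
  have hmem : MemLp (fun x : EuclideanSpace ℝ (Fin n) => x j) ∞ (volume.restrict Ω) := by
    refine memLp_top_of_bound (by fun_prop) C ?_
    filter_upwards [ae_restrict_mem hm] with x hx
    exact (PiLp.norm_apply_le x j).trans (hC x hx)
  refine ⟨(ContinuousLinearMap.lsmul ℝ ℝ : ℝ →L[ℝ] E →L[ℝ] E).holderL (volume.restrict Ω) ∞ 2 2
    (hmem.toLp _), fun u => ?_⟩
  filter_upwards [(ContinuousLinearMap.lsmul ℝ ℝ : ℝ →L[ℝ] E →L[ℝ] E).coeFn_holder (r := 2)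
    (hmem.toLp _) u, hmem.coeFn_toLp] with x h1 h2
  rw [ContinuousLinearMap.holderL_apply_apply, h1, h2, ContinuousLinearMap.lsmul_apply]

/-- Both sides are continuous in each pair separately, so the identity for test functions extends to
the closure one variable at a time. -/
theorem inner_by_parts {j : Fin n} {D : L2Field Ω →L[ℝ] L2Fun Ω}
    (hD : ∀ g, D g =ᵐ[volume.restrict Ω] fun x => g x j) {q r : L2Fun Ω × L2Field Ω}
    (hq : q ∈ H10 Ω) (hr : r ∈ H10 Ω) : inner ℝ (D q.2) r.1 = -inner ℝ q.1 (D r.2) := by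
  have h1 : ∀ q ∈ testPairs Ω, ∀ r ∈ testPairs Ω,
      inner ℝ (D q.2) r.1 = -inner ℝ q.1 (D r.2) := by
    rintro q ⟨φ, hφ, hq1, hq2⟩ r ⟨ψ, hψ, hr1, hr2⟩
    have e1 : inner ℝ (D q.2) r.1 = ∫ x, (∇ φ x) j * ψ x := by
      rw [L2.inner_def, ← setIntegral_eq_integral_of_forall_compl_eq_zero (s := Ω)
        (f := fun x => (∇ φ x) j * ψ x) fun x hx => by rw [hψ.eq_zero hx, mul_zero]]
      refine integral_congr_ae ?_
      filter_upwards [hD q.2, hq2, hr1] with x a b c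
      rw [a, b, c, real_inner_comm]
      simp [mul_comm]
    have e2 : inner ℝ q.1 (D r.2) = ∫ x, φ x * (∇ ψ x) j := by
      rw [L2.inner_def, ← setIntegral_eq_integral_of_forall_compl_eq_zero (s := Ω)
        (f := fun x => φ x * (∇ ψ x) j) fun x hx => by rw [hφ.eq_zero hx, zero_mul]]
      refine integral_congr_ae ?_
      filter_upwards [hD r.2, hr2, hq1] with x a b c
      rw [a, b, c]
      simp [mul_comm]
    rw [e1, e2, hφ.integral_mul_gradient hψ, neg_neg]
  have h2 : ∀ q ∈ testPairs Ω, inner ℝ (D q.2) r.1 = -inner ℝ q.1 (D r.2) := fun q hq =>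
    closure_minimal (t := {r : L2Fun Ω × L2Field Ω | inner ℝ (D q.2) r.1 = -inner ℝ q.1 (D r.2)})
      (fun r hr => h1 q hq r hr)
      (isClosed_eq (by fun_prop) (by fun_prop)) hr
  exact closure_minimal (t := {q : L2Fun Ω × L2Field Ω | inner ℝ (D q.2) r.1 = -inner ℝ q.1 (D r.2)})
    (fun q hq => h2 q hq)
    (isClosed_eq (by fun_prop) (by fun_prop)) hq

/-- Boundedness of Ω makes multiplication by x_j continuous on L², so the rule ∇(x_j φ) = x_j ∇φ + φ
e_j passes from test functions to H¹₀(Ω). -/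
theorem exists_isCoordinate (hΩ : Bornology.IsBounded Ω) (hm : MeasurableSet Ω) (j : Fin n) :
    ∃ (X : L2Fun Ω →ₗ[ℝ] L2Fun Ω) (Y : L2Field Ω →ₗ[ℝ] L2Field Ω) (D : L2Field Ω →ₗ[ℝ] L2Fun Ω)
      (E : L2Fun Ω →ₗ[ℝ] L2Field Ω), IsCoordinate (sobolevSubmodule Ω) X Y D E ∧
      (∀ g, D g =ᵐ[volume.restrict Ω] fun x => g x j) ∧
      ∀ u, X u =ᵐ[volume.restrict Ω] fun x => x j • u x := by
  obtain ⟨X, hX⟩ := exists_coord_mul hΩ hm j ℝ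
  obtain ⟨Y, hY⟩ := exists_coord_mul hΩ hm j (EuclideanSpace ℝ (Fin n))
  obtain ⟨D, hD⟩ : ∃ D : L2Field Ω →L[ℝ] L2Fun Ω,
      ∀ g, D g =ᵐ[volume.restrict Ω] fun x => g x j :=
    ⟨(EuclideanSpace.proj j : EuclideanSpace ℝ (Fin n) →L[ℝ] ℝ).compLpL 2 (volume.restrict Ω),
      fun g => ContinuousLinearMap.coeFn_compLpL _ g⟩
  obtain ⟨E, hE⟩ : ∃ E : L2Fun Ω →L[ℝ] L2Field Ω,
      ∀ u, E u =ᵐ[volume.restrict Ω] fun x => u x • EuclideanSpace.single j (1 : ℝ) :=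
    ⟨(ContinuousLinearMap.toSpanSingleton ℝ (EuclideanSpace.single j (1 : ℝ))).compLpL 2
      (volume.restrict Ω), fun u => ContinuousLinearMap.coeFn_compLpL _ u⟩
  refine ⟨X, Y, D, E, ⟨?_, ?_, ?_, ?_, ?_, ?_, ?_⟩, hD, hX⟩
  · intro u v
    change inner ℝ (X u) v = inner ℝ u (X v)
    rw [L2.inner_def, L2.inner_def]
    refine integral_congr_ae ?_
    filter_upwards [hX u, hX v] with x a b
    rw [a, b, real_inner_smul_left, real_inner_smul_right]
  · intro u v
    change inner ℝ (Y u) v = inner ℝ u (Y v)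
    rw [L2.inner_def, L2.inner_def]
    refine integral_congr_ae ?_
    filter_upwards [hY u, hY v] with x a b
    rw [a, b, real_inner_smul_left, real_inner_smul_right]
  · intro u g
    change inner ℝ (E u) g = inner ℝ u (D g)
    rw [L2.inner_def, L2.inner_def]
    refine integral_congr_ae ?_
    filter_upwards [hE u, hD g] with x a b
    rw [a, b, real_inner_smul_left, EuclideanSpace.inner_single_left]
    simp [mul_comm]
  · intro u
    change D (E u) = u
    refine Lp.ext ?_
    filter_upwards [hD (E u), hE u] with x a b
    rw [a, b]
    simp
  · intro g
    change D (Y g) = X (D g)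
    refine Lp.ext ?_
    filter_upwards [hD (Y g), hY g, hX (D g), hD g] with x a b c d
    rw [a, b, c, d]
    simp
  · intro q hq
    have hT : Continuous fun q : L2Fun Ω × L2Field Ω => (X q.1, Y q.2 + E q.1) := by fun_prop
    refine map_mem_closure (f := fun q : L2Fun Ω × L2Field Ω => (X q.1, Y q.2 + E q.1)) hT hq ?_
    rintro p ⟨φ, hφ, h1, h2⟩
    refine ⟨fun x => x j * φ x,
      hφ.mul_left (EuclideanSpace.proj (𝕜 := ℝ) j).contDiff, ?_, ?_⟩
    · filter_upwards [hX p.1, h1] with x a b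
      rw [a, b, smul_eq_mul]
    · filter_upwards [hY p.2, hE p.1, Lp.coeFn_add (Y p.2) (E p.1), h1, h2] with x a b c d e
      rw [c, Pi.add_apply, a, b, d, e, hφ.gradient_coord_mul]
  · intro q hq r hr
    exact inner_by_parts hD hq hr

theorem sum_norm_sq_components {D : Fin n → L2Field Ω →ₗ[ℝ] L2Fun Ω}
    (hD : ∀ j g, D j g =ᵐ[volume.restrict Ω] fun x => g x j) (g : L2Field Ω) :
    ∑ j, ‖D j g‖ ^ 2 = ‖g‖ ^ 2 := by
  simp only [norm_sq_eq_integral]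
  rw [← integral_finsetSum]
  · refine integral_congr_ae ?_
    filter_upwards [ae_all_iff.2 fun j => hD j g] with x hx
    rw [EuclideanSpace.norm_sq_eq]
    simp only [hx]
  · intro j _
    simpa only [Real.norm_eq_abs, sq_abs] using (Lp.memLp (D j g)).integrable_sq

/-- Multiplication with a coordinate has no eigenvectors. -/
theorem eq_zero_of_coord_mul_eq (j : Fin n) {X : L2Fun Ω →ₗ[ℝ] L2Fun Ω}
    (hX : ∀ u, X u =ᵐ[volume.restrict Ω] fun x => x j • u x) (c : ℝ) (u : L2Fun Ω)
    (h : X u = c • u) : u = 0 := by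
  -- A function fixed by x_j = c must live on a hyperplane, which is null.
  have hnull : volume {x : EuclideanSpace ℝ (Fin n) | x j = c} = 0 := by
    set S := AffineSubspace.mk' (EuclideanSpace.single j c)
      (LinearMap.ker (EuclideanSpace.proj (𝕜 := ℝ) j : EuclideanSpace ℝ (Fin n) →ₗ[ℝ] ℝ)) with hS
    have hmem : ∀ x, x ∈ S ↔ x j = c := fun x => by
      rw [hS, AffineSubspace.mem_mk', LinearMap.mem_ker]
      simp [sub_eq_zero]
    have hset : {x : EuclideanSpace ℝ (Fin n) | x j = c} = S := by
      ext x
      exact (hmem x).symm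
    rw [hset]
    refine Measure.addHaar_affineSubspace _ _ fun htop => ?_
    have : EuclideanSpace.single j (c + 1) ∈ S := htop ▸ AffineSubspace.mem_top ℝ _ _
    rw [hmem] at this
    simp at this
  have hne : ∀ᵐ x ∂(volume.restrict Ω), (x : EuclideanSpace ℝ (Fin n)) j ≠ c :=
    ae_restrict_of_ae (measure_eq_zero_iff_ae_notMem.1 hnull)
  refine Lp.ext ?_
  filter_upwards [hne, hX u, Lp.coeFn_smul c u, Lp.coeFn_zero ℝ 2 (volume.restrict Ω)]
    with x h1 h2 h3 h4
  rw [h, h3, Pi.smul_apply, smul_eq_mul, smul_eq_mul] at h2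
  rw [h4, Pi.zero_apply]
  have h5 : (x j - c) * u x = 0 := by linear_combination -h2
  exact (mul_eq_zero.1 h5).resolve_left (sub_ne_zero.2 h1)

/-- Both sides agree by unfolding: `sobolevSubmodule Ω` and `H10 Ω` are the same closure. -/
theorem dirichletEigenvalue_succ_eq {k : ℕ} {p : ℕ → L2Fun Ω × L2Field Ω} {l : ℕ → ℝ}
    (h : IsEigensystem (sobolevSubmodule Ω) (k + 1) p l) :
    dirichletEigenvalue Ω (k + 1) = l k :=
  h.sInf_eq

end Coordinates

/-! ### Conclusion for the Dirichlet Laplacian. -/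

theorem mainTheorem3 (n : ℕ) (hn : 1 ≤ n) (Ω : Set (EuclideanSpace ℝ (Fin n)))
    (hopen : IsOpen Ω) (hconn : IsConnected Ω) (hbdd : Bornology.IsBounded Ω)
    (m : ℕ) (hm : 1 ≤ m) :
    -- the inequality in `[0, ∞]`, where `a / 0 = ∞` for `a > 0`; it covers `λ_{m+1} = λ_m`
    ((m : ℝ≥0∞) * (n : ℝ≥0∞) / 4 ≤
      ∑ i ∈ Finset.Icc 1 m, ENNReal.ofReal (dirichletEigenvalue Ω i) /
        ENNReal.ofReal (dirichletEigenvalue Ω (m + 1) - dirichletEigenvalue Ω i)) ∧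
    -- the inequality in the reals, when no denominator vanishes
    (dirichletEigenvalue Ω m < dirichletEigenvalue Ω (m + 1) →
      (m : ℝ) * n / 4 ≤
        ∑ i ∈ Finset.Icc 1 m, dirichletEigenvalue Ω i /
          (dirichletEigenvalue Ω (m + 1) - dirichletEigenvalue Ω i)) ∧
    -- the resulting Payne–Pólya–Weinberger inequality
    dirichletEigenvalue Ω (m + 1) - dirichletEigenvalue Ω m ≤
      4 / ((m : ℝ) * n) * ∑ i ∈ Finset.Icc 1 m, dirichletEigenvalue Ω i := by
  have hmeas := hopen.measurableSet
  choose X Y D E hcoord hD hX using exists_isCoordinate hbdd hmeas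
  obtain ⟨p, l, hp⟩ := exists_isEigensystem (isClosed_sobolevSubmodule Ω)
    (totallyBounded_fst_H10 hbdd hmeas) (exists_fst_ne_zero hopen hconn.nonempty) (X ⟨0, hn⟩)
    (hcoord ⟨0, hn⟩).symm_fst (fun q hq => ⟨_, (hcoord ⟨0, hn⟩).leibniz q hq⟩)
    (eq_zero_of_coord_mul_eq ⟨0, hn⟩ (hX ⟨0, hn⟩)) (m + 1)
  -- The eigensystem is numbered from 0, the Dirichlet eigenvalues from 1.
  have heig : ∀ i ≤ m, dirichletEigenvalue Ω (i + 1) = l i := fun i hi =>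
    dirichletEigenvalue_succ_eq (hp.of_le (by omega))
  -- Poincaré applied to a normalised eigenfunction reads 1 ≤ C l i. Strict positivity is needed for
  -- a / 0 = ∞ below.
  have hpos : ∀ i ≤ m, 0 < l i := by
    intro i hi
    obtain ⟨C, hC, h⟩ := exists_poincare_H10 hn hbdd
    have h1 := h _ (hp.mem i (by omega))
    rw [hp.norm i (by omega), hp.norm_snd_sq (by omega)] at h1
    by_contra h2
    push Not at h2
    nlinarith
  have hsum : ∀ {M : Type} [AddCommMonoid M] (f : ℕ → M),
      ∑ i ∈ Finset.Icc 1 m, f i = ∑ i ∈ Finset.range m, f (i + 1) := fun f => by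
    rw [Finset.range_eq_Ico, Finset.sum_Ico_add' f 0 m 1]
    rfl
  have hm1 : dirichletEigenvalue Ω m = l (m - 1) := by
    have := heig (m - 1) (by omega)
    rwa [Nat.sub_add_cancel hm] at this
  have hmono : ∀ i < m, l i ≤ l (m - 1) := fun i hi => hp.monotone (by omega) (by omega)
  have hmm : l (m - 1) ≤ l m := hp.monotone (by omega) (by omega)
  have heigm := heig m le_rfl
  have hreal : l (m - 1) < l m → (m : ℝ) * n / 4 ≤ ∑ i ∈ Finset.range m, l i / (l m - l i) :=
    fun hlt => hileProtter hcoord (sum_norm_sq_components hD) hp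
      fun i hi => (hmono i hi).trans_lt hlt
  rw [hsum, hsum, hsum, heigm, hm1]
  have e : ∀ i ∈ Finset.range m, dirichletEigenvalue Ω (i + 1) = l i := fun i hi =>
    heig i (Finset.mem_range.1 hi).le
  rw [Finset.sum_congr rfl fun i hi => by rw [e i hi],
    Finset.sum_congr (g := fun i => l i / (l m - l i)) rfl fun i hi => by rw [e i hi],
    Finset.sum_congr rfl e]
  refine ⟨?_, hreal, ?_⟩
  · rcases hmm.eq_or_lt with heq | hlt
    · refine le_top.trans_eq (Eq.symm (ENNReal.sum_eq_top.2 ⟨m - 1, Finset.mem_range.2 (by omega), ?_⟩))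
      rw [heq, sub_self, ENNReal.ofReal_zero]
      exact ENNReal.div_zero (ENNReal.ofReal_pos.2 (hpos m le_rfl)).ne'
    · have h1 : ∀ i ∈ Finset.range m, 0 < l m - l i := fun i hi =>
        sub_pos.2 ((hmono i (Finset.mem_range.1 hi)).trans_lt hlt)
      rw [Finset.sum_congr rfl fun i hi => (ENNReal.ofReal_div_of_pos (h1 i hi)).symm,
        ← ENNReal.ofReal_sum_of_nonneg fun i hi =>
          div_nonneg (hpos i (Finset.mem_range.1 hi).le).le (h1 i hi).le]
      refine le_trans (le_of_eq ?_) (ENNReal.ofReal_le_ofReal (hreal hlt))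
      rw [ENNReal.ofReal_div_of_pos (by norm_num), ENNReal.ofReal_mul (by positivity),
        ENNReal.ofReal_natCast, ENNReal.ofReal_natCast, ENNReal.ofReal_ofNat]
  · rcases hmm.eq_or_lt with heq | hlt
    · rw [heq, sub_self]
      exact mul_nonneg (by positivity)
        (Finset.sum_nonneg fun i hi => (hpos i (Finset.mem_range.1 hi).le).le)
    · exact sub_le_of_hileProtter hm hn hmono (fun i hi => (hpos i hi.le).le) hlt (hreal hlt)
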